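/- Two-color Babylon is the following two-player game. It starts with $p$ chips of one color and $q$ chips of another color, each chip forming a stack of height $1$. The two players alternate moves; a move takes two different stacks that have the same number of chips or the same color on top (or both) and places one of them on top of the other. The player who makes the last legal move wins. Theorem: for all integers $1 \le p \le q$, the second player has a winning strategy if and only if $p+q$ is even and $p \ge 3$; in all the remaining cases (and only in those) the first player has a winning strategy. -/

import Mathlib

namespace Babylon

/-- The two colors of chips. -/
inductive Color where
  | red : Color
  | blue : Color

/-- A stack of chips, listed from top to bottom. (Every stack that occurs in a game is nonempty.) -/
abbrev Stack : Type := List Color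

/-- A position: the finite multiset of the stacks on the table. -/
abbrev Position : Type := Multiset Stack

/-- Two stacks may be combined if they have the same number of chips or the same color on top. -/
def Compatible (s t : Stack) : Prop :=
  s.length = t.length ∨ s.head? = t.head?

/-- `Move P Q`: a legal move leads from `P` to `Q`. Two compatible stacks `s` and `t` among the
stacks of `P` (two different members of the multiset) are combined by putting `s` on top of `t`. -/
def Move (P Q : Position) : Prop :=
  ∃ (s t : Stack) (R : Position),
    P = s ::ₘ t ::ₘ R ∧ Compatible s t ∧ Q = (s ++ t) ::ₘ R

mutual

/-- The player who is about to move at the position can force a win, under the rule that the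
player who makes the last legal move wins: some legal move leads to a position that is won for
the player who has just moved. -/
inductive FirstPlayerWins : Position → Prop
  | intro {P Q : Position} : Move P Q → SecondPlayerWins Q → FirstPlayerWins P

/-- The player who is not about to move at the position can force a win, under the rule that the
player who makes the last legal move wins: every legal move of the opponent leads to a position
that is won for the player who is then about to move. This includes the positions at which
no legal move exists. -/
inductive SecondPlayerWins : Position → Prop
  | intro {P : Position} : (∀ Q : Position, Move P Q → FirstPlayerWins Q) → SecondPlayerWins P

end

/-- The initial position: `p` red chips and `q` blue chips, each chip being its own stack. -/
def start (p q : ℕ) : Position :=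
  Multiset.replicate p [Color.red] + Multiset.replicate q [Color.blue]

end Babylon

namespace Babylon

-- Every move removes one stack, and play stops either at one stack or at two stacks of unequal
-- heights with different tops. Hence the winner is decided by whether one top color gets
-- extinguished. Only top colors and heights matter, so a position becomes a pair of multisets of
-- heights (left and right); a move merges two members of one side, or covers a member of one side
-- by an equal member of the other.
--
-- With an even number of stacks, the player not to move wants both colors to survive. If one side
-- is a single stack `h`, this player can keep the other side from ever ending at `h` by dodging a
-- few coincidences (`Lonely.sec`); `sec_pair` extends this to two stacks on one side.
--
-- For `p + q = 2 * N` the danger is that both sides end at height `N`. In the main family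
-- (`Main.sec`) each side is one possibly tall stack plus ones, both tall stacks having the parity
-- opposite to `N`. Replies normally restore this shape; when one side runs short of ones, they lead
-- to a pair or a lonely stack. Positions with three ones on one side need `sec_ones_three`, and
-- four small starts are checked by search.
--
-- For `p + q` odd the first player covers one chip, making the number of stacks even. From there a
-- tall stack on each side can be reached with odd height sum (`sec_cons_ones_cons_ones_of_odd`), so
-- that the two can never be equal. For `p + q` even and `p ≤ 2`, the first player instead aims to
-- extinguish a color: at once if `p = 1`, and after merging the two chips if `p = 2`.

theorem SecondPlayerWins.not_firstPlayerWins {P : Position} (h₂ : SecondPlayerWins P) :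
    ¬ FirstPlayerWins P := by
  obtain ⟨n, hn⟩ : ∃ n, n = Multiset.card P := ⟨_, rfl⟩
  induction n using Nat.strong_induction_on generalizing P with
  | _ n ih =>
    intro h₁
    cases h₁ with
    | intro hm hs =>
      cases h₂ with
      | intro h =>
        refine ih _ ?_ hs rfl (h _ hm)
        obtain ⟨s, t, R, rfl, -, rfl⟩ := hm
        simp [hn]

/-- All stacks of a position in which every stack shows the same top color may be combined, so
only the number of stacks matters. -/
theorem wins_of_head_eq {P : Position} (c : Option Color) (hc : ∀ s ∈ P, s.head? = c)
    (hne : ∀ s ∈ P, s ≠ []) :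
    (Odd (Multiset.card P) → SecondPlayerWins P) ∧
      (Even (Multiset.card P) → P ≠ 0 → FirstPlayerWins P) := by
  obtain ⟨n, hn⟩ : ∃ n, n = Multiset.card P := ⟨_, rfl⟩
  induction n using Nat.strong_induction_on generalizing P with
  | _ n ih =>
    have key : ∀ Q, Move P Q → (∀ s ∈ Q, s.head? = c) ∧ (∀ s ∈ Q, s ≠ []) ∧
        Multiset.card P = Multiset.card Q + 1 ∧ Q ≠ 0 := by
      rintro Q ⟨s, t, R, rfl, -, rfl⟩
      simp only [Multiset.mem_cons, forall_eq_or_imp] at hc hne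
      refine ⟨?_, ?_, by simp, by simp⟩
      · simp only [Multiset.mem_cons, forall_eq_or_imp]
        refine ⟨?_, hc.2.2⟩
        rw [List.head?_append_of_ne_nil _ hne.1]
        exact hc.1
      · simp only [Multiset.mem_cons, forall_eq_or_imp]
        exact ⟨by simp [hne.1], hne.2.2⟩
    refine ⟨fun ho => .intro fun Q hQ => ?_, fun he h0 => ?_⟩
    · obtain ⟨h1, h2, h3, h4⟩ := key Q hQ
      refine (ih _ (by omega) h1 h2 rfl).2 ?_ h4
      rw [h3] at ho
      grind
    · have h2 : 2 ≤ Multiset.card P := by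
        have := Multiset.card_pos.2 h0
        grind
      obtain ⟨s, hs⟩ := Multiset.exists_mem_of_ne_zero h0
      obtain ⟨R, rfl⟩ := Multiset.exists_cons_of_mem hs
      have hR : R ≠ 0 := by rintro rfl; simp at h2
      obtain ⟨t, ht⟩ := Multiset.exists_mem_of_ne_zero hR
      obtain ⟨S, rfl⟩ := Multiset.exists_cons_of_mem ht
      have hm : Move (s ::ₘ t ::ₘ S) _ := ⟨s, t, S, rfl, Or.inr ((hc _ (by simp)).trans
        (hc _ (by simp)).symm), rfl⟩
      obtain ⟨h1, h2, h3, h4⟩ := key _ hm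
      refine .intro hm ((ih _ (by omega) h1 h2 rfl).1 ?_)
      rw [h3] at he
      grind

-- Positions as pairs of multisets of heights.

/-- The multiset `A` lists the heights of the stacks of `P` with top color `c`, the multiset `B`
those of the stacks with top color `d`, and there are no other stacks. -/
def HasHeights (c d : Color) (P : Position) (A B : Multiset ℕ) : Prop :=
  P.map (fun s => (s.head?, s.length)) = A.map (fun a => (some c, a)) + B.map (fun b => (some d, b))

/-- The second player wins all positions with heights `A` for one top color and `B` for the
other one. -/
def Sec (A B : Multiset ℕ) : Prop :=
  ∀ c d P, c ≠ d → HasHeights c d P A B → SecondPlayerWins P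

/-- The first player wins all positions with heights `A` for one top color and `B` for the
other one. -/
def Fst (A B : Multiset ℕ) : Prop :=
  ∀ c d P, c ≠ d → HasHeights c d P A B → FirstPlayerWins P

theorem HasHeights.symm {c d : Color} {P : Position} {A B : Multiset ℕ}
    (h : HasHeights c d P A B) : HasHeights d c P B A := by
  rw [HasHeights, h, add_comm]

theorem Sec.symm {A B : Multiset ℕ} (h : Sec A B) : Sec B A :=
  fun c d P hcd hP => h d c P hcd.symm hP.symm

theorem Fst.symm {A B : Multiset ℕ} (h : Fst A B) : Fst B A :=
  fun c d P hcd hP => h d c P hcd.symm hP.symm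

theorem HasHeights.pos {c d : Color} {P : Position} {A B : Multiset ℕ}
    (h : HasHeights c d P A B) : ∀ a ∈ A, 0 < a := by
  intro a ha
  have : (some c, a) ∈ P.map (fun s => (s.head?, s.length)) := by
    rw [h, Multiset.mem_add]
    exact Or.inl (Multiset.mem_map_of_mem _ ha)
  obtain ⟨s, -, hs⟩ := Multiset.mem_map.1 this
  cases s with
  | nil => simp at hs
  | cons x s => simp at hs; omega

/-- A stack with a top color is nonempty, so positivity of all heights comes for free. -/
theorem Sec.of_pos {A B : Multiset ℕ}
    (h : (∀ a ∈ A, 0 < a) → (∀ b ∈ B, 0 < b) → Sec A B) : Sec A B :=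
  fun c d P hcd hP => h hP.pos hP.symm.pos c d P hcd hP

theorem Fst.of_pos {A B : Multiset ℕ}
    (h : (∀ a ∈ A, 0 < a) → (∀ b ∈ B, 0 < b) → Fst A B) : Fst A B :=
  fun c d P hcd hP => h hP.pos hP.symm.pos c d P hcd hP

theorem cons_eq_map_add_map {α : Type*} {x : α} {M : Multiset α} {A B : Multiset ℕ} {f g : ℕ → α}
    (h : x ::ₘ M = A.map f + B.map g) :
    (∃ a A', x = f a ∧ A = a ::ₘ A' ∧ M = A'.map f + B.map g) ∨
      ∃ b B', x = g b ∧ B = b ::ₘ B' ∧ M = A.map f + B'.map g := by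
  have hx : x ∈ A.map f + B.map g := h ▸ Multiset.mem_cons_self x M
  rcases Multiset.mem_add.1 hx with hx | hx
  · obtain ⟨a, ha, rfl⟩ := Multiset.mem_map.1 hx
    obtain ⟨A', rfl⟩ := Multiset.exists_cons_of_mem ha
    refine Or.inl ⟨a, A', rfl, rfl, ?_⟩
    rwa [Multiset.map_cons, Multiset.cons_add, Multiset.cons_inj_right] at h
  · obtain ⟨b, hb, rfl⟩ := Multiset.mem_map.1 hx
    obtain ⟨B', rfl⟩ := Multiset.exists_cons_of_mem hb
    refine Or.inr ⟨b, B', rfl, rfl, ?_⟩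
    rwa [Multiset.map_cons, Multiset.add_cons, Multiset.cons_inj_right] at h

-- Moves on heights.

/-- `Pick A a A'`: removing one copy of `a` from `A` leaves `A'`. -/
def Pick (A : Multiset ℕ) (a : ℕ) (A' : Multiset ℕ) : Prop := A = a ::ₘ A'

/-- `Merge A A'`: two members of `A` have been replaced by their sum. -/
def Merge (A A' : Multiset ℕ) : Prop := ∃ a R, Pick A a R ∧ ∃ b S, Pick R b S ∧ A' = (a + b) ::ₘ S

/-- `Cover A B A' B'`: a member of `A` has been doubled at the expense of an equal one of `B`. -/
def Cover (A B A' B' : Multiset ℕ) : Prop :=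
  ∃ a R, Pick A a R ∧ Pick B a B' ∧ A' = (2 * a) ::ₘ R

/-- `φ` holds for all results of a merge in `A`. -/
def AllMerges (A : Multiset ℕ) (φ : Multiset ℕ → Prop) : Prop := ∀ A', Merge A A' → φ A'

/-- `φ` holds for all members of `A` and the corresponding remainders. -/
def AllPicks (A : Multiset ℕ) (φ : ℕ → Multiset ℕ → Prop) : Prop := ∀ a A', Pick A a A' → φ a A'

/-- `φ` holds for the remainder of `A` after the removal of `a`, if that is possible. -/
def AllPicksOf (A : Multiset ℕ) (a : ℕ) (φ : Multiset ℕ → Prop) : Prop := ∀ A', Pick A a A' → φ A'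

/-- `φ` holds for all results of a cover of a member of `B` by one of `A`. -/
def AllCovers (A B : Multiset ℕ) (φ : Multiset ℕ → Multiset ℕ → Prop) : Prop :=
  ∀ A' B', Cover A B A' B' → φ A' B'

theorem Sec.intro {A B : Multiset ℕ} (hA : ∀ A', Merge A A' → Fst A' B)
    (hB : ∀ B', Merge B B' → Fst A B') (hAB : ∀ A' B', Cover A B A' B' → Fst A' B')
    (hBA : ∀ A' B', Cover B A B' A' → Fst A' B') : Sec A B := by
  intro c d P hcd hP
  refine .intro ?_
  rintro Q ⟨s, t, R, rfl, hst, rfl⟩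
  have hlab : ∀ e : Color, s.head? = some e →
      ((s ++ t).head?, (s ++ t).length) = (some e, s.length + t.length) := by
    intro e he
    cases s with
    | nil => simp at he
    | cons x s =>
      rw [List.head?_cons] at he
      simp only [List.cons_append, List.head?_cons, he, List.length_cons, List.length_append]
      congr 1
      omega
  rw [HasHeights, Multiset.map_cons, Multiset.map_cons] at hP
  rcases cons_eq_map_add_map hP with ⟨a, A', ha, rfl, h'⟩ | ⟨a, B', ha, rfl, h'⟩ <;>
    rcases cons_eq_map_add_map h' with ⟨b, A'', hb, rfl, h''⟩ | ⟨b, B'', hb, rfl, h''⟩ <;>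
    rw [Prod.ext_iff] at ha hb <;> obtain ⟨ha1, ha2⟩ := ha <;> obtain ⟨hb1, hb2⟩ := hb <;>
    simp only at ha1 ha2 hb1 hb2
  · refine hA _ ⟨a, _, rfl, b, _, rfl, rfl⟩ c d _ hcd ?_
    rw [HasHeights, Multiset.map_cons, h'', hlab _ ha1, Multiset.map_cons, Multiset.cons_add,
      ha2, hb2]
  · have : a = b := by
      rcases hst with h | h
      · omega
      · rw [ha1, hb1] at h; exact absurd (Option.some.inj h) hcd
    subst this
    refine hAB _ _ ⟨a, _, rfl, rfl, rfl⟩ c d _ hcd ?_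
    rw [HasHeights, Multiset.map_cons, h'', hlab _ ha1, Multiset.map_cons, Multiset.cons_add,
      ha2, hb2, two_mul]
  · have : a = b := by
      rcases hst with h | h
      · omega
      · rw [ha1, hb1] at h; exact absurd (Option.some.inj h) hcd.symm
    subst this
    refine hBA _ _ ⟨a, _, rfl, rfl, rfl⟩ c d _ hcd ?_
    rw [HasHeights, Multiset.map_cons, h'', hlab _ ha1, Multiset.map_cons, Multiset.add_cons,
      ha2, hb2, two_mul]
  · refine hB _ ⟨a, _, rfl, b, _, rfl, rfl⟩ c d _ hcd ?_
    rw [HasHeights, Multiset.map_cons, h'', hlab _ ha1, Multiset.map_cons, Multiset.add_cons,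
      ha2, hb2]

/-- `r` stacks of height `1`. -/
def ones (r : ℕ) : Multiset ℕ := Multiset.replicate r 1

theorem ones_zero : ones 0 = 0 := rfl

theorem ones_succ (r : ℕ) : ones (r + 1) = 1 ::ₘ ones r := Multiset.replicate_succ 1 r

@[simp] theorem card_ones (r : ℕ) : Multiset.card (ones r) = r := Multiset.card_replicate r 1

@[simp] theorem sum_ones (r : ℕ) : (ones r).sum = r := by simp [ones]

theorem exists_cons_of_map_eq_cons {α β : Type*} {f : α → β} {P : Multiset α} {x : β}
    {M : Multiset β} (h : P.map f = x ::ₘ M) : ∃ s R, P = s ::ₘ R ∧ f s = x ∧ R.map f = M := by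
  classical
  obtain ⟨s, hs, h1, h2⟩ := (Multiset.map_eq_cons f P M x).2 h
  exact ⟨s, P.erase s, (Multiset.cons_erase hs).symm, h1, h2⟩

/-- Exhibits a winning reply. The default proof of `hA` splits `ones` and reorders explicit
multisets, so a use only has to name the merged heights and the rest. -/
theorem Fst.mergeLeft {A B : Multiset ℕ} (a b : ℕ) (A' : Multiset ℕ) (h : Sec ((a + b) ::ₘ A') B)
    (hA : A = a ::ₘ b ::ₘ A' := by
      simp only [ones_succ, ones_zero, ← Multiset.singleton_add] <;> abel) : Fst A B := by
  subst hA
  intro c d P hcd hP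
  rw [HasHeights, Multiset.map_cons, Multiset.map_cons, Multiset.cons_add, Multiset.cons_add] at hP
  obtain ⟨s, R, rfl, hs, hR⟩ := exists_cons_of_map_eq_cons hP
  obtain ⟨t, R, rfl, ht, hR⟩ := exists_cons_of_map_eq_cons hR
  rw [Prod.ext_iff] at hs ht
  obtain ⟨hs1, hs2⟩ := hs
  obtain ⟨ht1, ht2⟩ := ht
  simp only at hs1 hs2 ht1 ht2
  refine .intro ⟨s, t, R, rfl, Or.inr (hs1.trans ht1.symm), rfl⟩ (h c d _ hcd ?_)
  cases s with
  | nil => simp at hs1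
  | cons x s =>
    simp at hs1 hs2
    simp [HasHeights, hR, hs1, ht2, ← hs2]
    ring

theorem Fst.coverLeft {A B : Multiset ℕ} (a : ℕ) (A' B' : Multiset ℕ) (h : Sec ((2 * a) ::ₘ A') B')
    (hA : A = a ::ₘ A' := by
      simp only [ones_succ, ones_zero, ← Multiset.singleton_add] <;> abel)
    (hB : B = a ::ₘ B' := by
      simp only [ones_succ, ones_zero, ← Multiset.singleton_add] <;> abel) : Fst A B := by
  subst hA hB
  intro c d P hcd hP
  rw [HasHeights, Multiset.map_cons, Multiset.map_cons, Multiset.cons_add, Multiset.add_cons] at hP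
  obtain ⟨s, R, rfl, hs, hR⟩ := exists_cons_of_map_eq_cons hP
  obtain ⟨t, R, rfl, ht, hR⟩ := exists_cons_of_map_eq_cons hR
  rw [Prod.ext_iff] at hs ht
  obtain ⟨hs1, hs2⟩ := hs
  obtain ⟨ht1, ht2⟩ := ht
  simp only at hs1 hs2 ht1 ht2
  refine .intro ⟨s, t, R, rfl, Or.inl (hs2.trans ht2.symm), rfl⟩ (h c d _ hcd ?_)
  cases s with
  | nil => simp at hs1
  | cons x s =>
    simp at hs1 hs2
    simp [HasHeights, hR, hs1, ht2, ← hs2]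
    ring

theorem Fst.mergeRight {A B : Multiset ℕ} (a b : ℕ) (B' : Multiset ℕ) (h : Sec A ((a + b) ::ₘ B'))
    (hB : B = a ::ₘ b ::ₘ B' := by
      simp only [ones_succ, ones_zero, ← Multiset.singleton_add] <;> abel) : Fst A B :=
  (Fst.mergeLeft a b B' h.symm hB).symm

theorem Fst.coverRight {A B : Multiset ℕ} (a : ℕ) (A' B' : Multiset ℕ)
    (h : Sec A' ((2 * a) ::ₘ B')) (hA : A = a ::ₘ A' := by
      simp only [ones_succ, ones_zero, ← Multiset.singleton_add] <;> abel)
    (hB : B = a ::ₘ B' := by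
      simp only [ones_succ, ones_zero, ← Multiset.singleton_add] <;> abel) : Fst A B :=
  (Fst.coverLeft a B' A' h.symm hB hA).symm

/-- This form of `Sec.intro` lets the `simp` lemmas below expand the opponent's moves on explicit
multisets into a finite list of cases. -/
theorem Sec.of_forall {A B : Multiset ℕ} (hA : AllMerges A fun A' => Fst A' B)
    (hB : AllMerges B fun B' => Fst A B') (hAB : AllCovers A B Fst)
    (hBA : AllCovers B A fun B' A' => Fst A' B') : Sec A B :=
  .intro hA hB hAB fun A' B' => hBA B' A'

theorem mem_ones {r a : ℕ} : a ∈ ones r ↔ r ≠ 0 ∧ a = 1 := Multiset.mem_replicate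

theorem count_ones (r a : ℕ) : Multiset.count a (ones r) = if 1 = a then r else 0 :=
  Multiset.count_replicate a 1 r

theorem pick_zero {a : ℕ} {A : Multiset ℕ} : Pick 0 a A ↔ False := by simp [Pick]

theorem pick_cons {x a : ℕ} {R A : Multiset ℕ} :
    Pick (x ::ₘ R) a A ↔ (a = x ∧ A = R) ∨ ∃ R', Pick R a R' ∧ A = x ::ₘ R' := by
  unfold Pick
  rw [Multiset.cons_eq_cons]
  constructor
  · rintro (⟨rfl, rfl⟩ | ⟨-, cs, rfl, rfl⟩)
    · exact Or.inl ⟨rfl, rfl⟩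
    · exact Or.inr ⟨cs, rfl, rfl⟩
  · rintro (⟨rfl, rfl⟩ | ⟨cs, rfl, rfl⟩)
    · exact Or.inl ⟨rfl, rfl⟩
    · by_cases h : x = a
      · subst h; exact Or.inl ⟨rfl, rfl⟩
      · exact Or.inr ⟨h, cs, rfl, rfl⟩

theorem pick_ones {r a : ℕ} {A : Multiset ℕ} :
    Pick (ones r) a A ↔ a = 1 ∧ ∃ r', r = r' + 1 ∧ A = ones r' := by
  unfold Pick
  constructor
  · intro h
    have ha : a = 1 := (mem_ones.1 (h ▸ Multiset.mem_cons_self a A)).2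
    subst ha
    cases r with
    | zero => simp [ones_zero] at h
    | succ r => rw [ones_succ, Multiset.cons_inj_right] at h; exact ⟨rfl, r, rfl, h.symm⟩
  · rintro ⟨rfl, r, rfl, rfl⟩
    exact ones_succ r

theorem merge_zero {D : Multiset ℕ} : Merge 0 D ↔ False := by simp [Merge, pick_zero]

theorem merge_cons {a : ℕ} {C D : Multiset ℕ} :
    Merge (a ::ₘ C) D ↔
      (∃ b C', Pick C b C' ∧ D = (a + b) ::ₘ C') ∨ ∃ C', Merge C C' ∧ D = a ::ₘ C' := by
  unfold Merge
  constructor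
  · rintro ⟨x, R, hx, y, S, hy, rfl⟩
    rcases pick_cons.1 hx with ⟨rfl, rfl⟩ | ⟨R', hR', rfl⟩
    · exact Or.inl ⟨y, S, hy, rfl⟩
    · rcases pick_cons.1 hy with ⟨rfl, rfl⟩ | ⟨S', hS', rfl⟩
      · exact Or.inl ⟨x, _, hR', by rw [add_comm]⟩
      · exact Or.inr ⟨_, ⟨x, _, hR', y, _, hS', rfl⟩, Multiset.cons_swap _ _ _⟩
  · rintro (⟨b, C', hb, rfl⟩ | ⟨C', ⟨x, R, hx, y, S, hy, rfl⟩, rfl⟩)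
    · exact ⟨a, C, rfl, b, C', hb, rfl⟩
    · refine ⟨x, a ::ₘ R, pick_cons.2 (Or.inr ⟨R, hx, rfl⟩), y, a ::ₘ S,
        pick_cons.2 (Or.inr ⟨S, hy, rfl⟩), Multiset.cons_swap _ _ _⟩

theorem merge_ones {r : ℕ} {D : Multiset ℕ} :
    Merge (ones r) D ↔ ∃ r', r = r' + 2 ∧ D = 2 ::ₘ ones r' := by
  unfold Merge
  constructor
  · rintro ⟨x, R, hx, y, S, hy, rfl⟩
    obtain ⟨rfl, r', rfl, rfl⟩ := pick_ones.1 hx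
    obtain ⟨rfl, r', rfl, rfl⟩ := pick_ones.1 hy
    exact ⟨r', rfl, rfl⟩
  · rintro ⟨r', rfl, rfl⟩
    exact ⟨1, _, pick_ones.2 ⟨rfl, _, rfl, rfl⟩, 1, _, pick_ones.2 ⟨rfl, _, rfl, rfl⟩, rfl⟩

theorem Merge.exists_eq {A A' : Multiset ℕ} (h : Merge A A') :
    ∃ a b R, A = a ::ₘ b ::ₘ R ∧ A' = (a + b) ::ₘ R := by
  obtain ⟨a, _, rfl, b, R, rfl, rfl⟩ := h
  exact ⟨a, b, R, rfl, rfl⟩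

theorem Merge.sum_eq {A A' : Multiset ℕ} (h : Merge A A') : A'.sum = A.sum := by
  obtain ⟨a, b, R, rfl, rfl⟩ := h.exists_eq
  simp [add_assoc]

theorem Merge.card_eq {A A' : Multiset ℕ} (h : Merge A A') :
    Multiset.card A = Multiset.card A' + 1 := by
  obtain ⟨a, b, R, rfl, rfl⟩ := h.exists_eq
  simp

theorem pick_singleton {x a : ℕ} {A : Multiset ℕ} : Pick {x} a A ↔ a = x ∧ A = 0 := by
  rw [← Multiset.cons_zero, pick_cons]
  simp [pick_zero]

theorem merge_singleton {a : ℕ} {D : Multiset ℕ} : Merge {a} D ↔ False := by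
  rw [← Multiset.cons_zero, merge_cons]
  simp [pick_zero, merge_zero]

theorem allPicks_cons {x : ℕ} {R : Multiset ℕ} {φ : ℕ → Multiset ℕ → Prop} :
    AllPicks (x ::ₘ R) φ ↔ φ x R ∧ AllPicks R fun a A' => φ a (x ::ₘ A') := by
  simp only [AllPicks, pick_cons]
  constructor
  · exact fun h => ⟨h _ _ (Or.inl ⟨rfl, rfl⟩), fun a A' h' => h _ _ (Or.inr ⟨A', h', rfl⟩)⟩
  · rintro ⟨h1, h2⟩ a A' (⟨rfl, rfl⟩ | ⟨R', hR', rfl⟩)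
    exacts [h1, h2 _ _ hR']

theorem allPicks_singleton {x : ℕ} {φ : ℕ → Multiset ℕ → Prop} : AllPicks {x} φ ↔ φ x 0 := by
  simp [AllPicks, pick_singleton]

theorem allPicks_ones {r : ℕ} {φ : ℕ → Multiset ℕ → Prop} :
    AllPicks (ones r) φ ↔ ∀ r', r = r' + 1 → φ 1 (ones r') := by
  simp only [AllPicks, pick_ones]
  exact ⟨fun h r' hr => h _ _ ⟨rfl, r', hr, rfl⟩, by
    rintro h a A' ⟨rfl, r', hr, rfl⟩; exact h r' hr⟩

theorem allPicksOf_cons {x a : ℕ} {R : Multiset ℕ} {φ : Multiset ℕ → Prop} :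
    AllPicksOf (x ::ₘ R) a φ ↔ (a = x → φ R) ∧ AllPicksOf R a fun A' => φ (x ::ₘ A') := by
  simp only [AllPicksOf, pick_cons]
  constructor
  · exact fun h => ⟨fun ha => h _ (Or.inl ⟨ha, rfl⟩), fun A' h' => h _ (Or.inr ⟨A', h', rfl⟩)⟩
  · rintro ⟨h1, h2⟩ A' (⟨ha, rfl⟩ | ⟨R', hR', rfl⟩)
    exacts [h1 ha, h2 _ hR']

theorem allPicksOf_singleton {x a : ℕ} {φ : Multiset ℕ → Prop} :
    AllPicksOf {x} a φ ↔ (a = x → φ 0) := by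
  simp [AllPicksOf, pick_singleton]

theorem allPicksOf_ones {r a : ℕ} {φ : Multiset ℕ → Prop} :
    AllPicksOf (ones r) a φ ↔ (a = 1 → ∀ r', r = r' + 1 → φ (ones r')) := by
  simp only [AllPicksOf, pick_ones]
  exact ⟨fun h ha r' hr => h _ ⟨ha, r', hr, rfl⟩, by
    rintro h A' ⟨ha, r', hr, rfl⟩; exact h ha r' hr⟩

theorem allMerges_cons {a : ℕ} {C : Multiset ℕ} {φ : Multiset ℕ → Prop} :
    AllMerges (a ::ₘ C) φ ↔
      (AllPicks C fun b C' => φ ((a + b) ::ₘ C')) ∧ AllMerges C fun C' => φ (a ::ₘ C') := by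
  simp only [AllMerges, AllPicks, merge_cons]
  constructor
  · exact fun h => ⟨fun b C' h' => h _ (Or.inl ⟨b, C', h', rfl⟩),
      fun C' h' => h _ (Or.inr ⟨C', h', rfl⟩)⟩
  · rintro ⟨h1, h2⟩ A' (⟨b, C', h, rfl⟩ | ⟨C', h, rfl⟩)
    exacts [h1 _ _ h, h2 _ h]

theorem allMerges_singleton {a : ℕ} {φ : Multiset ℕ → Prop} : AllMerges {a} φ ↔ True := by
  simp [AllMerges, merge_singleton]

theorem allMerges_ones {r : ℕ} {φ : Multiset ℕ → Prop} :
    AllMerges (ones r) φ ↔ ∀ r', r = r' + 2 → φ (2 ::ₘ ones r') := by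
  simp only [AllMerges, merge_ones]
  exact ⟨fun h r' hr => h _ ⟨r', hr, rfl⟩, by rintro h A' ⟨r', hr, rfl⟩; exact h r' hr⟩

theorem allCovers_iff {A B : Multiset ℕ} {φ : Multiset ℕ → Multiset ℕ → Prop} :
    AllCovers A B φ ↔ AllPicks A fun a A' => AllPicksOf B a fun B' => φ ((2 * a) ::ₘ A') B' := by
  simp only [AllCovers, AllPicks, AllPicksOf, Cover]
  exact ⟨fun h a A' h1 B' h2 => h _ _ ⟨a, A', h1, h2, rfl⟩, by
    rintro h A' B' ⟨a, A', h1, h2, rfl⟩; exact h a A' h1 B' h2⟩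

theorem not_cover_of_disjoint {A B A' B' : Multiset ℕ} (h : ∀ a ∈ A, a ∉ B) :
    ¬ Cover A B A' B' := by
  rintro ⟨x, R, rfl, rfl, rfl⟩
  exact h x (by simp) (by simp)

theorem exists_max_cons {B : Multiset ℕ} (h : B ≠ 0) :
    ∃ m R, B = m ::ₘ R ∧ ∀ z ∈ R, z ≤ m := by
  obtain ⟨m, hm, hmax⟩ := B.toFinset.exists_max_image id
    (Multiset.toFinset_nonempty.2 h)
  rw [Multiset.mem_toFinset] at hm
  obtain ⟨R, rfl⟩ := Multiset.exists_cons_of_mem hm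
  refine ⟨m, R, rfl, fun z hz => hmax z ?_⟩
  simp [hz]

theorem exists_cons_of_card_pos {B : Multiset ℕ} (h : 0 < Multiset.card B) :
    ∃ m R, B = m ::ₘ R := by
  obtain ⟨m, hm⟩ := Multiset.exists_mem_of_ne_zero (Multiset.card_pos.1 h)
  exact ⟨m, Multiset.exists_cons_of_mem hm⟩

-- A single stack against many.

/-- The conditions under which a single stack of height `h` cannot be covered in the end. -/
structure Lonely (h : ℕ) (B : Multiset ℕ) : Prop where
  notMem : h ∉ B
  odd_card : Multiset.card B % 2 = 1
  sum_ne : B.sum ≠ h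
  -- Prevents a merge after which at least four stacks remain, all of height `h / 2`, when every
  -- reply would create `h`. Such a `B` has no member above `y`, and exactly two members different
  -- from `y`.
  unbalanced : ∀ y, h = 2 * y → (∃ b ∈ B, y < b) ∨
    Multiset.count y B + 3 ≤ Multiset.card B ∨ Multiset.card B ≤ 3

/-- The conditions under which a move leads to a lonely stack. -/
structure AlmostLonely (h : ℕ) (B : Multiset ℕ) : Prop where
  even_card : Multiset.card B % 2 = 0
  card_pos : 0 < Multiset.card B
  sum_ne : B.sum ≠ h
  -- One merge can use up two copies of `h`, but not three.
  count_le : Multiset.count h B ≤ 2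
  exists_ne : Multiset.card B = 2 ∨ ∃ b ∈ B, 2 * b ≠ h

/-- If `h` occurs, it is merged with its second copy or any other stack, giving more than `h`.
Otherwise the tallest stack is enlarged, unless every such merge would give `h`. -/
theorem AlmostLonely.exists_lonely {h : ℕ} {B : Multiset ℕ} (H : AlmostLonely h B) (hh : 0 < h)
    (hB : ∀ b ∈ B, 0 < b) : ∃ a b R, B = a ::ₘ b ::ₘ R ∧ Lonely h ((a + b) ::ₘ R) := by
  obtain ⟨h1, h2, h3, h4, h5⟩ := H
  by_cases hm : h ∈ B
  · obtain ⟨R, rfl⟩ := Multiset.exists_cons_of_mem hm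
    simp only [Multiset.count_cons_self, Multiset.card_cons, Multiset.sum_cons] at *
    obtain ⟨z, R', rfl, hz⟩ : ∃ z R', R = z ::ₘ R' ∧ h ∉ R' := by
      by_cases hR : h ∈ R
      · obtain ⟨R', rfl⟩ := Multiset.exists_cons_of_mem hR
        simp only [Multiset.count_cons_self] at h4
        exact ⟨h, R', rfl, Multiset.count_eq_zero.1 (by omega)⟩
      · obtain ⟨z, R', rfl⟩ := exists_cons_of_card_pos (B := R) (by omega)
        exact ⟨z, R', rfl, fun h => hR (by simp [h])⟩
    have hz0 : 0 < z := hB z (by simp)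
    simp only [Multiset.card_cons, Multiset.sum_cons] at *
    refine ⟨h, z, R', rfl, ?_, ?_, ?_, fun y hy => Or.inl ⟨h + z, by simp, by omega⟩⟩
    · simp only [Multiset.mem_cons, not_or]
      exact ⟨by omega, hz⟩
    · simp only [Multiset.card_cons]; omega
    · simp only [Multiset.sum_cons]; omega
  · obtain ⟨m, R, rfl, hmax⟩ := exists_max_cons (B := B) (by rintro rfl; simp at h2)
    by_cases hz : ∃ z ∈ R, m + z ≠ h
    · obtain ⟨z, hzR, hz⟩ := hz
      obtain ⟨R, rfl⟩ := Multiset.exists_cons_of_mem hzR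
      have hz0 : 0 < z := hB z (by simp)
      simp only [Multiset.card_cons, Multiset.sum_cons, Multiset.mem_cons, not_or] at *
      refine ⟨m, z, R, rfl, ?_, ?_, ?_, fun y hy => ?_⟩
      · simp only [Multiset.mem_cons, not_or]
        exact ⟨by omega, hm.2.2⟩
      · simp only [Multiset.card_cons]; omega
      · simp only [Multiset.sum_cons]; omega
      · by_cases hy' : y < m + z
        · exact Or.inl ⟨_, Multiset.mem_cons_self _ _, hy'⟩
        -- All other stacks are at most `m < y`, so only the merged stack itself can have height
        -- `y`.
        · refine Or.inr ?_
          have hyR : y ∉ R := fun hyR => by have := hmax y (Or.inr hyR); omega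
          have hc : Multiset.count y ((m + z) ::ₘ R) ≤ 1 := by
            rw [Multiset.count_cons, Multiset.count_eq_zero.2 hyR]
            split_ifs <;> omega
          simp only [Multiset.card_cons] at *
          omega
    -- Now all stacks but `m` have the same height `w = h - m`, and `w < m`. Merging two of them
    -- gives `2 * w < h` and leaves `m` above `h / 2`.
    · push Not at hz
      simp only [Multiset.card_cons, Multiset.sum_cons, Multiset.mem_cons, not_or] at *
      obtain ⟨z, R, rfl⟩ := exists_cons_of_card_pos (B := R) (by omega)
      have hz1 := hz z (by simp)
      simp only [Multiset.card_cons, Multiset.sum_cons, Multiset.mem_cons, not_or] at *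
      have h5' := h5.resolve_left (fun hc => by
        have : R = 0 := Multiset.card_eq_zero.1 (by omega)
        subst this; simp at h3; omega)
      obtain ⟨w, R, rfl⟩ := exists_cons_of_card_pos (B := R) (by
        rcases Nat.eq_zero_or_pos (Multiset.card R) with hc | hc
        · rw [Multiset.card_eq_zero] at hc
          subst hc; simp at h3; omega
        · exact hc)
      have hw := hz w (by simp)
      obtain rfl : w = z := by omega
      have hmz : w < m := by
        refine lt_of_le_of_ne (hmax w (by simp)) fun he => ?_
        subst he
        obtain ⟨b, hb, hb2⟩ := h5'
        rcases hb with rfl | hb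
        · omega
        · have := hz b hb; omega
      refine ⟨w, w, m ::ₘ R, ?_, ?_, ?_, ?_, fun y hy => Or.inl ⟨m, by simp, by omega⟩⟩
      · rw [Multiset.cons_swap m, Multiset.cons_swap m]
      · simp only [Multiset.mem_cons, not_or] at hm ⊢
        refine ⟨by omega, by omega, hm.2.2.2⟩
      · simp only [Multiset.card_cons] at *; omega
      · simp only [Multiset.sum_cons] at *; omega

theorem Lonely.almostLonely {h : ℕ} {B B' : Multiset ℕ} (H : Lonely h B) (hm : Merge B B') :
    AlmostLonely h B' := by
  obtain ⟨h1, h2, h3, h4⟩ := H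
  have hs := hm.sum_eq
  obtain ⟨a, b, R, rfl, rfl⟩ := hm.exists_eq
  simp only [Multiset.card_cons, Multiset.mem_cons, not_or] at *
  refine ⟨by simp only [Multiset.card_cons]; omega, by simp, by omega, ?_, ?_⟩
  · rw [Multiset.count_cons, Multiset.count_eq_zero.2 h1.2.2]
    split_ifs <;> omega
  · by_contra! hc
    obtain ⟨hc1, hc2⟩ := hc
    simp only [Multiset.card_cons, Multiset.mem_cons, forall_eq_or_imp] at hc1 hc2
    have hR : Multiset.count (a + b) R = Multiset.card R :=
      Multiset.count_eq_card.2 fun x hx => by have := hc2.2 x hx; omega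
    rcases h4 (a + b) hc2.1.symm with ⟨x, hx | hx | hx, hlt⟩ | hle | hle
    · omega
    · omega
    · have := hc2.2 x hx; omega
    · have : Multiset.count (a + b) R ≤ Multiset.count (a + b) (a ::ₘ b ::ₘ R) :=
        (Multiset.count_le_count_cons _ _ _).trans (Multiset.count_le_count_cons _ _ _)
      omega
    · omega

/-- The hypothesis `ih` is what the induction in `Lonely.sec` supplies; `AlmostLonely.fst`
discharges it afterwards. -/
theorem AlmostLonely.fst_of {h : ℕ} {B : Multiset ℕ} (H : AlmostLonely h B)
    (ih : ∀ B', Multiset.card B' < Multiset.card B → Lonely h B' → Sec {h} B') : Fst {h} B := by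
  refine Fst.of_pos fun hh hB => ?_
  obtain ⟨a, b, R, rfl, hL⟩ := H.exists_lonely (hh h (by simp)) hB
  exact .mergeRight a b R (ih _ (by simp) hL) rfl

theorem Lonely.sec {h : ℕ} {B : Multiset ℕ} (H : Lonely h B) : Sec {h} B := by
  obtain ⟨n, hn⟩ : ∃ n, n = Multiset.card B := ⟨_, rfl⟩
  induction n using Nat.strong_induction_on generalizing B with
  | _ n ih =>
    refine .intro (fun A' hA => by simp [merge_singleton] at hA) (fun B' hB => ?_)
      (fun A' B' hc => absurd hc (not_cover_of_disjoint (by simpa using H.notMem)))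
      (fun A' B' hc => absurd hc (not_cover_of_disjoint ?_))
    · have := hB.card_eq
      exact (H.almostLonely hB).fst_of fun B'' hlt hL => ih _ (by omega) hL rfl
    · intro a ha hah
      rw [Multiset.mem_singleton] at hah
      exact H.notMem (hah ▸ ha)

theorem AlmostLonely.fst {h : ℕ} {B : Multiset ℕ} (H : AlmostLonely h B) : Fst {h} B :=
  H.fst_of fun _ _ hL => hL.sec

/-- A merge in `B` is answered by merging the pair into a lonely stack `a + c`. If the opponent has
just created a stack of that height, it is enlarged instead and the pair waits. -/
theorem sec_pair {a c : ℕ} {B : Multiset ℕ} (ha : a ∉ B) (hc : c ∉ B) (hac : a + c ∉ B)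
    (hcard : Multiset.card B % 2 = 0) (hpos : 0 < Multiset.card B) (hsum : B.sum ≠ a + c)
    (hbal : ∀ y, a + c = 2 * y → (∃ b ∈ B, y < b) ∨ y ∉ B) : Sec (a ::ₘ {c}) B := by
  obtain ⟨n, hn⟩ : ∃ n, n = Multiset.card B := ⟨_, rfl⟩
  induction n using Nat.strong_induction_on generalizing B with
  | _ n ih =>
  refine Sec.of_pos fun hposA hposB => ?_
  simp only [Multiset.mem_cons, Multiset.mem_singleton, forall_eq_or_imp, forall_eq] at hposA
  refine .intro (fun A' hA => ?_) (fun B' hB => ?_)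
    (fun A' B' h => absurd h (not_cover_of_disjoint ?_))
    (fun A' B' h => absurd h (not_cover_of_disjoint ?_))
  · simp only [merge_cons, merge_singleton, pick_singleton, false_and, exists_false, or_false] at hA
    obtain ⟨_, _, ⟨rfl, rfl⟩, rfl⟩ := hA
    rw [Multiset.cons_zero]
    refine AlmostLonely.fst ⟨hcard, hpos, hsum, by rw [Multiset.count_eq_zero.2 hac]; omega, ?_⟩
    by_contra! hne
    obtain ⟨b, hb⟩ := Multiset.exists_mem_of_ne_zero (Multiset.card_pos.1 hpos)
    have hb2 := hne.2 b hb
    rcases hbal b hb2.symm with ⟨x, hx, hlt⟩ | hn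
    · have := hne.2 x hx; omega
    · exact hn hb
  · have hs := hB.sum_eq
    have hca := hB.card_eq
    by_cases hm : a + c ∈ B'
    · obtain ⟨u, v, R, rfl, rfl⟩ := hB.exists_eq
      simp only [Multiset.mem_cons, not_or, forall_eq_or_imp, Multiset.card_cons] at *
      have huv : a + c = u + v := hm.resolve_right hac.2.2
      obtain ⟨z, R, rfl⟩ := exists_cons_of_card_pos (B := R) (by
        rcases Nat.eq_zero_or_pos (Multiset.card R) with hc | hc
        · rw [Multiset.card_eq_zero] at hc
          subst hc; simp at hsum; omega
        · exact hc)
      simp only [Multiset.mem_cons, not_or, forall_eq_or_imp, Multiset.card_cons,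
        Multiset.sum_cons] at *
      refine .mergeRight (u + v) z R (ih _ ?_ ?_ ?_ ?_ ?_ ?_ ?_ ?_ rfl) rfl
      · simp only [Multiset.card_cons]; omega
      · simp only [Multiset.mem_cons, not_or]; exact ⟨by omega, ha.2.2.2⟩
      · simp only [Multiset.mem_cons, not_or]; exact ⟨by omega, hc.2.2.2⟩
      · simp only [Multiset.mem_cons, not_or]; exact ⟨by omega, hac.2.2.2⟩
      · simp only [Multiset.card_cons]; omega
      · simp only [Multiset.card_cons]; omega
      · simp only [Multiset.sum_cons]; omega
      · exact fun y hy => Or.inl ⟨_, Multiset.mem_cons_self _ _, by omega⟩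
    · refine .mergeLeft a c 0 ?_ rfl
      rw [Multiset.cons_zero]
      refine Lonely.sec ⟨hm, by omega, by omega, fun y hy => ?_⟩
      obtain ⟨u, v, R, rfl, rfl⟩ := hB.exists_eq
      simp only [Multiset.mem_cons, not_or, exists_eq_or_imp, Multiset.card_cons] at *
      rcases hbal y hy with (hlt | hlt | ⟨b, hb, hlt⟩) | hn
      · left; left; omega
      · left; left; omega
      · left; right; exact ⟨b, hb, hlt⟩
      · right
        have : Multiset.count y ((u + v) ::ₘ R) ≤ 1 := by
          rw [Multiset.count_cons, Multiset.count_eq_zero.2 hn.2.2]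
          split_ifs <;> omega
        omega
  · simp only [Multiset.mem_cons, Multiset.mem_singleton, forall_eq_or_imp, forall_eq]
    exact ⟨ha, hc⟩
  · intro b hb hb'
    simp only [Multiset.mem_cons, Multiset.mem_singleton] at hb'
    rcases hb' with rfl | rfl
    · exact ha hb
    · exact hc hb

-- Arithmetic criteria for a few stacks plus ones; `h = 2` is special because then `h / 2` is the
-- height of the ones.

theorem lonely_ones {h s : ℕ} (h1 : h ≠ 1) (h2 : h ≠ 2) (hs : s % 2 = 1) (hne : s ≠ h) :
    Lonely h (ones s) := by
  refine ⟨by simp [mem_ones, h1], by simpa, by simpa, fun y hy => Or.inr ?_⟩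
  rw [count_ones, card_ones, if_neg (by omega)]
  omega

theorem lonely_cons {h x s : ℕ} (hx : h ≠ x) (h1 : h ≠ 1 ∨ s = 0) (h2 : h ≠ 2 ∨ 1 < x)
    (hs : s % 2 = 0) (hne : x + s ≠ h) : Lonely h (x ::ₘ ones s) := by
  refine ⟨?_, by simp; omega, by simpa, fun y hy => ?_⟩
  · simp only [Multiset.mem_cons, mem_ones]; omega
  · by_cases hy1 : y = 1
    · exact Or.inl ⟨x, by simp, by omega⟩
    · right
      simp only [Multiset.count_cons, count_ones, Multiset.card_cons, card_ones]
      split_ifs <;> omega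

theorem lonely_cons_cons {h x y s : ℕ} (hx : h ≠ x) (hy : h ≠ y) (h1 : h ≠ 1)
    (h2 : h ≠ 2 ∨ 1 < x ∨ 1 < y) (hs : s % 2 = 1) (hne : x + y + s ≠ h) :
    Lonely h (x ::ₘ y ::ₘ ones s) := by
  refine ⟨?_, by simp; omega, by simp; omega, fun z hz => ?_⟩
  · simp only [Multiset.mem_cons, mem_ones]; omega
  · by_cases hz1 : z = 1
    · left
      simp only [Multiset.mem_cons, exists_eq_or_imp]
      omega
    · right
      simp only [Multiset.count_cons, count_ones, Multiset.card_cons, card_ones]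
      split_ifs <;> omega

theorem lonely_cons_cons_cons {h x y z s : ℕ} (hx : h ≠ x) (hy : h ≠ y) (hz : h ≠ z) (h1 : h ≠ 1)
    (h2 : h ≠ 2 ∨ 1 < x ∨ 1 < y ∨ 1 < z) (hs : s % 2 = 0) (hne : x + y + z + s ≠ h)
    (hne' : s ≠ 2 ∨ h ≠ 2 * x ∨ h ≠ 2 * y ∨ h ≠ 2 * z) :
    Lonely h (x ::ₘ y ::ₘ z ::ₘ ones s) := by
  refine ⟨?_, by simp; omega, by simpa [add_assoc] using hne, fun w hw => ?_⟩
  · simp only [Multiset.mem_cons, mem_ones]; omega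
  · by_cases hw1 : w = 1
    · left
      simp only [Multiset.mem_cons, exists_eq_or_imp]
      omega
    · right
      simp only [Multiset.count_cons, count_ones, Multiset.card_cons, card_ones]
      split_ifs <;> omega

theorem almostLonely_cons {h x s : ℕ} (h1 : h ≠ 1) (h2 : h ≠ 2) (hs : s % 2 = 1)
    (hne : x + s ≠ h) : AlmostLonely h (x ::ₘ ones s) := by
  refine ⟨by simp; omega, by simp, by simpa, ?_, Or.inr ⟨1, ?_, by omega⟩⟩
  · simp only [Multiset.count_cons, count_ones]
    split_ifs <;> omega
  · exact Multiset.mem_cons_of_mem (mem_ones.2 ⟨by omega, rfl⟩)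

theorem almostLonely_cons_cons {h x y s : ℕ} (h1 : h ≠ 1) (h2 : h ≠ 2 ∨ 1 < x ∨ 1 < y)
    (hs : s % 2 = 0) (hne : x + y + s ≠ h) : AlmostLonely h (x ::ₘ y ::ₘ ones s) := by
  refine ⟨by simp; omega, by simp, by simp; omega, ?_, ?_⟩
  · simp only [Multiset.count_cons, count_ones]
    split_ifs <;> omega
  · simp only [Multiset.mem_cons, exists_eq_or_imp, Multiset.card_cons, card_ones, mem_ones]
    by_cases h0 : s = 0
    · omega
    · by_cases h2 : h = 2
      · omega
      · exact Or.inr (Or.inr (Or.inr ⟨1, ⟨h0, rfl⟩, by omega⟩))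

theorem almostLonely_cons_cons_cons {h x y z s : ℕ} (h1 : h ≠ 1)
    (h2 : h ≠ 2 ∨ 1 < x ∨ 1 < y ∨ 1 < z) (hs : s % 2 = 1) (hne : x + y + z + s ≠ h)
    (hne' : h ≠ x ∨ h ≠ y ∨ h ≠ z) : AlmostLonely h (x ::ₘ y ::ₘ z ::ₘ ones s) := by
  refine ⟨by simp; omega, by simp, by simp; omega, ?_, Or.inr ?_⟩
  · simp only [Multiset.count_cons, count_ones]
    split_ifs <;> omega
  · simp only [Multiset.mem_cons, exists_eq_or_imp, mem_ones]
    by_cases h2 : h = 2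
    · omega
    · exact Or.inr (Or.inr (Or.inr ⟨1, ⟨by omega, rfl⟩, by omega⟩))

theorem Fst.mergePair {a c : ℕ} {B : Multiset ℕ} (h : Lonely (a + c) B) : Fst (a ::ₘ {c}) B :=
  .mergeLeft a c 0 h.sec

-- Two or three stacks on one side against a few stacks plus ones.

theorem sec_pair_cons_ones {a c x s : ℕ} (ha : 2 ≤ a) (hc : 2 ≤ c) (hx : a + c < x)
    (hs : s % 2 = 1) (hne : x + s ≠ a + c) : Sec (a ::ₘ {c}) (x ::ₘ ones s) := by
  refine sec_pair ?_ ?_ ?_ (by simp; omega) (by simp) (by simpa)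
    fun y hy => Or.inl ⟨x, by simp, by omega⟩ <;>
  simp only [Multiset.mem_cons, mem_ones] <;> omega

theorem fst_pair_two {a x s : ℕ} (ha : 4 ≤ a) (hs : s % 2 = 0) (h2 : 2 ≤ s)
    (hne : x + s ≠ a + 2) :
    Fst (2 ::ₘ {a}) (x ::ₘ ones s) := by
  by_cases hx : x = a + 2
  · obtain ⟨s, rfl⟩ := Nat.exists_eq_add_of_le' (show 1 ≤ s by omega)
    exact .mergeRight x 1 (ones s) (sec_pair_cons_ones (by omega) (by omega) (by omega) (by omega)
      (by omega))
  · exact .mergePair (lonely_cons (by omega) (by omega) (by omega) (by omega) (by omega))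

/-- The left side may end at `a`, which differs from `N` by parity, or at `a + 1`, which differs by
hypothesis. This choice absorbs the coincidences. -/
theorem sec_pair_one {N a x s : ℕ} (ha : 4 ≤ a) (hN : a + 1 + x + s = 2 * N)
    (hpar : a % 2 ≠ N % 2) (hne : a + 1 ≠ N) (hs : s % 2 = 1) (h3 : 3 ≤ s) :
    Sec (a ::ₘ {1}) (x ::ₘ ones s) := by
  refine Sec.of_forall ?_ ?_ ?_ ?_ <;> simp only [allCovers_iff, allMerges_cons,
    allMerges_singleton, allMerges_ones, allPicks_cons, allPicks_singleton, allPicks_ones,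
    allPicksOf_cons, allPicksOf_singleton, allPicksOf_ones, mul_one, and_true, Multiset.cons_zero]
  · exact (almostLonely_cons (by omega) (by omega) (by omega) (by omega)).fst
  · refine ⟨?_, ?_⟩
    · rintro s rfl
      by_cases hx : x = a
      · obtain ⟨s, rfl⟩ := Nat.exists_eq_add_of_le' (show 1 ≤ s by omega)
        -- The left merge would produce `a + 1 = x + 1`, so the left one is covered and `a` stays
        -- alone.
        exact .coverRight 1 {a} ((x + 1) ::ₘ ones s) (Lonely.sec (lonely_cons_cons
          (by omega) (by omega) (by omega) (by omega) (by omega) (by omega)))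
      · exact .mergePair (lonely_cons (by omega) (by omega) (by omega) (by omega) (by omega))
    · rintro s rfl
      exact .mergePair (lonely_cons_cons (by omega) (by omega) (by omega) (by omega) (by omega)
        (by omega))
  · refine ⟨⟨?_, ?_⟩, ?_, ?_⟩
    · rintro rfl
      by_cases hx : 2 * a + 1 = N
      · obtain ⟨s, rfl⟩ := Nat.exists_eq_add_of_le' (show 1 ≤ s by omega)
        exact .coverRight 1 {2 * a} (ones s) (Lonely.sec (lonely_cons
          (by omega) (by omega) (by omega) (by omega) (by omega)))
      · exact .mergePair (lonely_ones (by omega) (by omega) (by omega) (by omega))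
    · omega
    · rintro rfl
      obtain ⟨s, rfl⟩ := Nat.exists_eq_add_of_le' (show 1 ≤ s by omega)
      rw [ones_succ]
      exact fst_pair_two ha (by omega) (by omega) (by omega)
    · rintro - s rfl
      exact fst_pair_two ha (by omega) (by omega) (by omega)
  · refine ⟨⟨?_, ?_⟩, ?_⟩
    · rintro rfl
      obtain ⟨s, rfl⟩ := Nat.exists_eq_add_of_le' (show 1 ≤ s by omega)
      -- The only left stack is a one and could be covered; it escapes by covering a one itself.
      exact .coverLeft 1 0 ((2 * x) ::ₘ ones s) (Lonely.sec (lonely_cons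
          (by omega) (by omega) (by omega) (by omega) (by omega)))
    · rintro rfl
      exact (almostLonely_cons (by omega) (by omega) (by omega) (by omega)).fst
    · rintro s rfl
      refine ⟨by omega, fun _ => ?_⟩
      exact (almostLonely_cons_cons (by omega) (by omega) (by omega) (by omega)).fst

/-- Here `N = g + 2`: the left total is `N - 1`, the right one `N + 1`. Serves where `sec_pair_one`
fails because the left side would end at `N`. -/
theorem sec_pair_one_of_balanced {g x c : ℕ} (hg : 3 ≤ g) (hx : 1 ≤ x) (h : x + c = g + 1)
    (hc : c % 2 = 0) (h2 : 2 ≤ c) : Sec (g ::ₘ {1}) (x ::ₘ 2 ::ₘ ones c) := by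
  have key : ∀ c', c = c' + 1 → Fst (2 ::ₘ {g}) (x ::ₘ 2 ::ₘ ones c') := by
    rintro c rfl
    -- Both totals are now `g + 2`, so merging the left pair is fatal; one 2 has to cover the other.
    -- The right one may do so unless the resulting 4 equals `g`.
    by_cases hg4 : g = 4
    · subst hg4
      refine .coverLeft 2 {4} (x ::ₘ ones c) (sec_pair ?_ ?_ ?_ (by simp; omega) (by simp)
        (by simp; omega) fun y hy => Or.inr ?_) <;>
      simp only [Multiset.mem_cons, mem_ones] <;> omega
    · exact .coverRight 2 {g} (x ::ₘ ones c) (Lonely.sec (lonely_cons_cons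
          (by omega) (by omega) (by omega) (by omega) (by omega) (by omega)))
  refine Sec.of_forall ?_ ?_ ?_ ?_ <;> simp only [allCovers_iff, allMerges_cons,
    allMerges_singleton, allMerges_ones, allPicks_cons, allPicks_singleton, allPicks_ones,
    allPicksOf_cons, allPicksOf_singleton, allPicksOf_ones, mul_one, and_true, Multiset.cons_zero]
  · exact (almostLonely_cons_cons (by omega) (by omega) (by omega) (by omega)).fst
  · refine ⟨⟨?_, ?_⟩, ?_, ?_⟩
    · by_cases hx : x + 2 = g + 1
      · obtain ⟨c, rfl⟩ := Nat.exists_eq_add_of_le' (show 1 ≤ c by omega)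
        exact .coverRight 1 {g} ((x + 2) ::ₘ ones c) (Lonely.sec (lonely_cons_cons
          (by omega) (by omega) (by omega) (by omega) (by omega) (by omega)))
      · exact .mergePair (lonely_cons (by omega) (by omega) (by omega) (by omega) (by omega))
    · rintro c rfl
      exact .mergePair (lonely_cons_cons (by omega) (by omega) (by omega) (by omega) (by omega)
        (by omega))
    · rintro c rfl
      exact .mergePair (lonely_cons_cons (by omega) (by omega) (by omega) (by omega) (by omega)
        (by omega))
    · rintro c rfl
      exact .mergePair (lonely_cons_cons_cons (by omega) (by omega) (by omega) (by omega)
        (by omega) (by omega) (by omega) (by omega))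
  · refine ⟨⟨by omega, by omega, by omega⟩, ?_, by omega, fun _ => key⟩
    rintro rfl
    obtain ⟨c, rfl⟩ := Nat.exists_eq_add_of_le' (show 1 ≤ c by omega)
    rw [ones_succ, Multiset.cons_swap]
    exact key c rfl
  · refine ⟨⟨by omega, ?_⟩, ⟨by omega, by omega⟩, ?_⟩
    · rintro rfl
      exact (almostLonely_cons_cons (by omega) (by omega) (by omega) (by omega)).fst
    · rintro c rfl
      refine ⟨by omega, fun _ => ?_⟩
      exact (almostLonely_cons_cons_cons (by omega) (by omega) (by omega) (by omega)
        (by omega)).fst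

/-- The heights `h + 2` and `h + 4` differ from `N` by parity, so merging the left pair is safe
unless the right side shows that very height. -/
theorem sec_pair_pair_two {N h x b : ℕ} (hh : 2 ≤ h) (hx : 1 ≤ x)
    (hN : h + 2 + x + 2 + b = 2 * N) (hpar : h % 2 ≠ N % 2) (hb : b % 2 = 0) :
    Sec (h ::ₘ {2}) (x ::ₘ 2 ::ₘ ones b) := by
  induction b using Nat.strong_induction_on generalizing x with
  | _ b ih =>
  have key : Fst (4 ::ₘ {h}) (x ::ₘ ones b) := by
    by_cases hx : x = h + 4
    · obtain ⟨b, rfl⟩ := Nat.exists_eq_add_of_le' (show 1 ≤ b by omega)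
      exact .mergeRight x 1 (ones b) (sec_pair_cons_ones (by omega) (by omega) (by omega)
        (by omega) (by omega))
    · exact .mergePair (lonely_cons (by omega) (by omega) (by omega) (by omega) (by omega))
  refine Sec.of_forall ?_ ?_ ?_ ?_ <;> simp only [allCovers_iff, allMerges_cons,
    allMerges_singleton, allMerges_ones, allPicks_cons, allPicks_singleton, allPicks_ones,
    allPicksOf_cons, allPicksOf_singleton, allPicksOf_ones, mul_one, and_true, Multiset.cons_zero]
  · exact (almostLonely_cons_cons (by omega) (by omega) (by omega) (by omega)).fst
  · refine ⟨⟨?_, ?_⟩, ?_, ?_⟩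
    · by_cases hx : x = h
      · obtain ⟨b, rfl⟩ := Nat.exists_eq_add_of_le' (show 1 ≤ b by omega)
        exact .mergeRight (x + 2) 1 (ones b) (sec_pair_cons_ones (by omega) (by omega) (by omega)
          (by omega) (by omega))
      · exact .mergePair (lonely_cons (by omega) (by omega) (by omega) (by omega) (by omega))
    · rintro b rfl
      exact .mergePair (lonely_cons_cons (by omega) (by omega) (by omega) (by omega) (by omega)
        (by omega))
    · rintro b rfl
      by_cases hx : x = h + 2
      · exact .mergeRight x 3 (ones b) (sec_pair_cons_ones (by omega) (by omega) (by omega)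
          (by omega) (by omega))
      · exact .mergePair (lonely_cons_cons (by omega) (by omega) (by omega) (by omega) (by omega)
          (by omega))
    · rintro b rfl
      by_cases hx : x = h + 2
      · exact .mergeRight x 2 (2 ::ₘ ones b) (ih b (by omega) (by omega) (by omega) (by omega))
      · exact .mergePair (lonely_cons_cons_cons (by omega) (by omega) (by omega) (by omega)
          (by omega) (by omega) (by omega) (by omega))
  · refine ⟨⟨?_, ?_, by omega⟩, ?_, fun _ => key, by omega⟩
    · rintro rfl
      by_cases hx : 2 * h + 2 = N
      · exact .coverRight 2 {2 * h} (ones b) (Lonely.sec (lonely_cons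
          (by omega) (by omega) (by omega) (by omega) (by omega)))
      · exact .mergePair (lonely_cons (by omega) (by omega) (by omega) (by omega) (by omega))
    · rintro rfl
      exact key
    · rintro rfl
      exact key
  · refine ⟨⟨?_, ?_⟩, ⟨?_, fun _ => ?_⟩, fun b hb => ⟨by omega, by omega⟩⟩
    · rintro rfl
      exact (almostLonely_cons_cons (by omega) (by omega) (by omega) (by omega)).fst
    · rintro rfl
      exact (almostLonely_cons_cons (by omega) (by omega) (by omega) (by omega)).fst
    · rintro rfl
      exact (almostLonely_cons_cons (by omega) (by omega) (by omega) (by omega)).fst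
    · exact (almostLonely_cons_cons (by omega) (by omega) (by omega) (by omega)).fst

/-- The right side is much heavier than the three chips on the left. When the left merge would match
a right stack, that stack is first raised by a one. -/
theorem sec_two_one_cons {x b : ℕ} (hx : 1 < x) (hx2 : x % 2 = 0) (hb : b % 2 = 1)
    (h : 9 ≤ x + b) : Sec (2 ::ₘ {1}) (x ::ₘ ones b) := by
  induction b using Nat.strong_induction_on generalizing x with
  | _ b ih =>
  refine Sec.of_forall ?_ ?_ ?_ ?_ <;> simp only [allCovers_iff, allMerges_cons,
    allMerges_singleton, allMerges_ones, allPicks_cons, allPicks_singleton, allPicks_ones,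
    allPicksOf_cons, allPicksOf_singleton, allPicksOf_ones, mul_one, and_true, Multiset.cons_zero]
  · exact (almostLonely_cons (by omega) (by omega) (by omega) (by omega)).fst
  · refine ⟨?_, ?_⟩
    · rintro b rfl
      by_cases hx2 : x = 2
      · subst hx2
        obtain ⟨b, rfl⟩ := Nat.exists_eq_add_of_le' (show 1 ≤ b by omega)
        exact .mergeRight 3 1 (ones b) (ih b (by omega) (by omega) (by omega) (by omega)
          (by omega))
      · exact .mergePair (lonely_cons (by omega) (by omega) (by omega) (by omega) (by omega))
    · rintro b rfl
      exact .mergePair (lonely_cons_cons (by omega) (by omega) (by omega) (by omega) (by omega)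
        (by omega))
  · refine ⟨⟨?_, by omega⟩, by omega, ?_⟩
    · rintro rfl
      exact .mergePair (lonely_ones (by omega) (by omega) (by omega) (by omega))
    · rintro - b rfl
      by_cases hx4 : x = 4
      · subst hx4
        obtain ⟨b, rfl⟩ := Nat.exists_eq_add_of_le' (show 1 ≤ b by omega)
        exact .mergeRight 4 1 (ones b) (sec_pair_cons_ones (by omega) (by omega) (by omega)
          (by omega) (by omega))
      · exact .mergePair (lonely_cons (by omega) (by omega) (by omega) (by omega) (by omega))
  · refine ⟨⟨?_, by omega⟩, ?_⟩
    · rintro rfl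
      obtain ⟨b, rfl⟩ := Nat.exists_eq_add_of_le' (show 1 ≤ b by omega)
      exact .coverLeft 1 0 ((2 * 2) ::ₘ ones b) (Lonely.sec (lonely_cons
        (by omega) (by omega) (by omega) (by omega) (by omega)))
    · rintro b rfl
      refine ⟨by omega, fun _ => ?_⟩
      exact (almostLonely_cons_cons (by omega) (by omega) (by omega) (by omega)).fst

theorem sec_two_one_cons_two {x b : ℕ} (hx : x % 2 = 1) (hb : b % 2 = 0) (h : 7 ≤ x + b) :
    Sec (2 ::ₘ {1}) (x ::ₘ 2 ::ₘ ones b) := by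
  induction b using Nat.strong_induction_on generalizing x with
  | _ b ih =>
  have key : ∀ b', b = b' + 1 → Fst (2 ::ₘ {2}) (x ::ₘ 2 ::ₘ ones b') := by
    rintro b rfl
    exact .mergePair (lonely_cons_cons (by omega) (by omega) (by omega) (by omega) (by omega)
      (by omega))
  have key' : ∀ b', b = b' + 1 → Fst {2} (2 ::ₘ x ::ₘ 2 ::ₘ ones b') := by
    rintro b rfl
    exact (almostLonely_cons_cons_cons (by omega) (by omega) (by omega) (by omega) (by omega)).fst
  refine Sec.of_forall ?_ ?_ ?_ ?_ <;> simp only [allCovers_iff, allMerges_cons,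
    allMerges_singleton, allMerges_ones, allPicks_cons, allPicks_singleton, allPicks_ones,
    allPicksOf_cons, allPicksOf_singleton, allPicksOf_ones, mul_one, and_true, Multiset.cons_zero]
  · exact (almostLonely_cons_cons (by omega) (by omega) (by omega) (by omega)).fst
  · refine ⟨⟨?_, ?_⟩, ?_, ?_⟩
    · by_cases hx1 : x = 1
      · subst hx1
        obtain ⟨b, rfl⟩ := Nat.exists_eq_add_of_le' (show 1 ≤ b by omega)
        exact .mergeRight (1 + 2) 1 (ones b) (sec_two_one_cons (by omega) (by omega) (by omega)
          (by omega))
      · exact .mergePair (lonely_cons (by omega) (by omega) (by omega) (by omega) (by omega))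
    · rintro b rfl
      exact .mergePair (lonely_cons_cons (by omega) (by omega) (by omega) (by omega) (by omega)
        (by omega))
    · rintro b rfl
      exact .mergeRight x (2 + 1) (ones b) (sec_two_one_cons (by omega) (by omega) (by omega)
        (by omega))
    · rintro b rfl
      by_cases hx3 : x = 3
      · exact .mergeRight x 2 (2 ::ₘ ones b) (ih b (by omega) (by omega) (by omega) (by omega))
      · exact .mergePair (lonely_cons_cons_cons (by omega) (by omega) (by omega) (by omega)
          (by omega) (by omega) (by omega) (by omega))
  · refine ⟨⟨by omega, ?_, by omega⟩, ?_, by omega, fun _ => key⟩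
    · intro _
      by_cases hx5 : x = 5
      · obtain ⟨b, rfl⟩ := Nat.exists_eq_add_of_le' (show 1 ≤ b by omega)
        exact .coverRight 1 {2 * 2} (x ::ₘ ones b) (Lonely.sec (lonely_cons_cons
          (by omega) (by omega) (by omega) (by omega) (by omega) (by omega)))
      · exact .mergePair (lonely_cons (by omega) (by omega) (by omega) (by omega) (by omega))
    · rintro rfl
      obtain ⟨b, rfl⟩ := Nat.exists_eq_add_of_le' (show 1 ≤ b by omega)
      rw [ones_succ, Multiset.cons_swap]
      exact key b rfl
  · refine ⟨⟨by omega, ?_⟩, ⟨?_, by omega⟩, ?_⟩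
    · rintro rfl
      obtain ⟨b, rfl⟩ := Nat.exists_eq_add_of_le' (show 1 ≤ b by omega)
      rw [ones_succ, Multiset.cons_swap 2 1]
      exact key' b rfl
    · intro _
      by_cases hb0 : b = 0
      · subst hb0
        exact .mergeRight (2 * 2) x (ones 0) (Lonely.sec (lonely_cons
          (by omega) (by omega) (by omega) (by omega) (by omega)))
      · obtain ⟨b, rfl⟩ := Nat.exists_eq_add_of_le' (show 1 ≤ b by omega)
        exact .coverLeft 1 0 ((2 * 2) ::ₘ x ::ₘ ones b) (Lonely.sec (lonely_cons_cons
          (by omega) (by omega) (by omega) (by omega) (by omega) (by omega)))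
    · intro b hb
      exact ⟨by omega, fun _ => key' b hb⟩

/-- All moves except a left merge are answered so that the left side becomes 2 and 1. No parity
condition on half the total is needed. -/
theorem sec_ones_three {x s : ℕ} (hx : x % 2 = 1) (hs : s % 2 = 0) (h2 : 2 ≤ s)
    (h : 9 ≤ x + s) : Sec (ones 3) (x ::ₘ ones s) := by
  have key : ∀ s', s = s' + 1 → Fst (2 ::ₘ ones 2) (x ::ₘ ones s') := by
    rintro s rfl
    obtain ⟨s, rfl⟩ := Nat.exists_eq_add_of_le' (show 1 ≤ s by omega)
    refine .coverRight 1 (2 ::ₘ {1}) (x ::ₘ ones s) ?_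
    rw [Multiset.cons_swap]
    exact sec_two_one_cons_two (by omega) (by omega) (by omega)
  have key' : ∀ s', s = s' + 1 → Fst (ones 2) (2 ::ₘ x ::ₘ ones s') := by
    rintro s rfl
    obtain ⟨s, rfl⟩ := Nat.exists_eq_add_of_le' (show 1 ≤ s by omega)
    refine .coverLeft 1 {1} (2 ::ₘ x ::ₘ ones s) ?_
    rw [Multiset.cons_swap 2 x]
    exact sec_two_one_cons_two (by omega) (by omega) (by omega)
  refine Sec.of_forall ?_ ?_ ?_ ?_ <;> simp only [allCovers_iff, allMerges_cons,
    allMerges_ones, allPicks_cons, allPicks_ones, allPicksOf_cons, allPicksOf_ones, mul_one]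
  · intro r hr
    obtain rfl : r = 1 := by omega
    by_cases hx3 : x = 3
    · obtain ⟨s, rfl⟩ := Nat.exists_eq_add_of_le' (show 1 ≤ s by omega)
      exact .mergeRight x 1 (ones s) (sec_two_one_cons (by omega) (by omega) (by omega)
        (by omega))
    · exact .mergePair (lonely_cons (by omega) (by omega) (by omega) (by omega) (by omega))
  · refine ⟨?_, ?_⟩
    · rintro s rfl
      exact .mergeLeft 1 1 {1} (sec_two_one_cons (by omega) (by omega) (by omega) (by omega))
    · rintro s rfl
      exact .mergeLeft 1 1 {1} (sec_two_one_cons_two (by omega) (by omega) (by omega))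
  · intro r hr
    obtain rfl : r = 2 := by omega
    refine ⟨?_, fun _ => key⟩
    rintro rfl
    obtain ⟨s, rfl⟩ := Nat.exists_eq_add_of_le' (show 1 ≤ s by omega)
    rw [ones_succ s]
    exact key s rfl
  · refine ⟨?_, ?_⟩
    · rintro rfl r hr
      obtain rfl : r = 2 := by omega
      obtain ⟨s, rfl⟩ := Nat.exists_eq_add_of_le' (show 1 ≤ s by omega)
      rw [ones_succ s]
      exact key' s rfl
    · rintro s hs - r hr
      obtain rfl : r = 2 := by omega
      exact key' s hs

-- The main family.

/-- The parameters of the main family of positions, in which each color has one stack that is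
allowed to be tall and at least two further stacks of height `1`. -/
structure Main (N h x r s : ℕ) : Prop where
  sum_eq : h + x + r + s = 2 * N
  -- As `r + s` is even, `x` has the parity of `h`.
  parity : h % 2 ≠ N % 2
  even : (r + s) % 2 = 0
  hr : 2 ≤ r
  hs : 2 ≤ s
  hh : 1 ≤ h
  hx : 1 ≤ x
  large : 6 ≤ N ∨ 2 ≤ h ∧ 2 ≤ x

theorem Main.symm {N h x r s : ℕ} (H : Main N h x r s) : Main N x h s r := by
  obtain ⟨h1, h2, h3, h4, h5, h6, h7, h8⟩ := H
  constructor <;> omega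

/-- With enough ones left, the move and the reply together raise `h` by 2 and keep the family.
Otherwise the left side shrinks to at most two stacks, or a right one covers a left one to reach
such a pair. -/
theorem allMerges_of_main {N h x r s : ℕ} (H : Main N h x r s) (hr : ¬ (h = 1 ∧ r = 2))
    (ih : ∀ h' x' r' s', r' + s' < r + s → Main N h' x' r' s' →
      Sec (h' ::ₘ ones r') (x' ::ₘ ones s')) :
    AllMerges (h ::ₘ ones r) fun A' => Fst A' (x ::ₘ ones s) := by
  obtain ⟨h1, h2, h3, h4, h5, h6, h7, h8⟩ := H
  simp only [allMerges_cons, allMerges_ones, allPicks_ones]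
  refine ⟨?_, ?_⟩
  · rintro r rfl
    obtain rfl | rfl | hr3 : r = 1 ∨ r = 2 ∨ 3 ≤ r := by omega
    · by_cases hxh : x = h + 2
      · obtain ⟨s, rfl⟩ := Nat.exists_eq_add_of_le' (show 1 ≤ s by omega)
        exact .coverRight 1 {h + 1} (x ::ₘ ones s) (Lonely.sec (lonely_cons_cons
          (by omega) (by omega) (by omega) (by omega) (by omega) (by omega)))
      · exact .mergePair (lonely_cons (by omega) (by omega) (by omega) (by omega) (by omega))
    · obtain ⟨s, rfl⟩ := Nat.exists_eq_add_of_le' (show 1 ≤ s by omega)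
      by_cases hh1 : h = 1
      · subst hh1
        refine .coverRight 1 (2 ::ₘ {1}) (x ::ₘ ones s) ?_
        rw [Multiset.cons_swap]
        exact sec_two_one_cons_two (by omega) (by omega) (by omega)
      -- `h + 3` is the left total if the left side simply goes on merging.
      by_cases hN : h + 3 = N
      · refine .coverRight 1 ((h + 1) ::ₘ {1}) (x ::ₘ ones s) ?_
        rw [Multiset.cons_swap]
        exact sec_pair_one_of_balanced (by omega) (by omega) (by omega) (by omega) (by omega)
      · exact .mergeLeft (h + 1) 1 {1} (sec_pair_one (N := N) (by omega) (by omega) (by omega)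
          (by omega) (by omega) (by omega))
    · obtain ⟨r, rfl⟩ := Nat.exists_eq_add_of_le' (show 1 ≤ r by omega)
      exact .mergeLeft (h + 1) 1 (ones r) (ih (h + 1 + 1) x r s (by omega)
        (by constructor <;> omega))
  · rintro r rfl
    obtain rfl | rfl | hr3 : r = 0 ∨ r = 1 ∨ 2 ≤ r := by omega
    · by_cases hxh : x = h + 2
      · obtain ⟨s, rfl⟩ := Nat.exists_eq_add_of_le' (show 1 ≤ s by omega)
        exact .mergeRight x 1 (ones s) (sec_pair_cons_ones (by omega) (by omega) (by omega)
          (by omega) (by omega))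
      · exact .mergePair (lonely_cons (by omega) (by omega) (by omega) (by omega) (by omega))
    · obtain ⟨s, rfl⟩ := Nat.exists_eq_add_of_le' (show 1 ≤ s by omega)
      by_cases hh1 : h = 1
      · subst hh1
        refine .coverRight 1 (2 ::ₘ {1}) (x ::ₘ ones s) ?_
        rw [Multiset.cons_swap]
        exact sec_two_one_cons_two (by omega) (by omega) (by omega)
      · refine .coverRight 1 (h ::ₘ {2}) (x ::ₘ ones s) ?_
        rw [Multiset.cons_swap]
        exact sec_pair_pair_two (N := N) (by omega) (by omega) (by omega) (by omega) (by omega)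
    · exact .mergeLeft h 2 (ones r) (ih (h + 2) x r s (by omega) (by constructor <;> omega))

theorem fst_of_single_cover {N h x r s : ℕ} (H : Main N h x r s) (hr : ¬ (h = 1 ∧ r = 2))
    (hs : ¬ (x = 1 ∧ s = 2))
    (ih : ∀ h' x' r' s', r' + s' < r + s → Main N h' x' r' s' →
      Sec (h' ::ₘ ones r') (x' ::ₘ ones s'))
    {r' s' : ℕ} (hr' : r = r' + 1) (hs' : s = s' + 1) :
    Fst (2 ::ₘ h ::ₘ ones r') (x ::ₘ ones s') := by
  obtain ⟨h1, h2, h3, h4, h5, h6, h7, h8⟩ := H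
  subst hr' hs'
  obtain rfl | hr2 : r' = 1 ∨ 2 ≤ r' := by omega
  · obtain ⟨s, rfl⟩ := Nat.exists_eq_add_of_le' (show 1 ≤ s' by omega)
    refine .coverRight 1 (h ::ₘ {2}) (x ::ₘ ones s) ?_
    rw [Multiset.cons_swap]
    exact sec_pair_pair_two (N := N) (by omega) (by omega) (by omega) (by omega) (by omega)
  obtain rfl | hs2 : s' = 1 ∨ 2 ≤ s' := by omega
  -- The right side is `x` and a single one; if their sum is the forbidden `N`, that one is covered.
  · by_cases hN : x + 1 = N
    · obtain ⟨r, rfl⟩ := Nat.exists_eq_add_of_le' (show 1 ≤ r' by omega)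
      refine .coverLeft 1 (2 ::ₘ h ::ₘ ones r) {x} (Lonely.sec (lonely_cons_cons_cons
        (by omega) (by omega) (by omega) (by omega) (by omega) (by omega) (by omega)
        (by omega))).symm
    · exact Fst.symm (.mergePair (lonely_cons_cons (by omega) (by omega) (by omega) (by omega)
        (by omega) (by omega)))
  · exact .mergeLeft h 2 (ones r') (ih (h + 2) x r' s' (by omega) (by constructor <;> omega))

/-- The right side has lost its tall stack. With enough ones it rejoins the family with new tall
stack 2 or 1. -/
theorem fst_of_main_cover {N h x r s : ℕ} (H : Main N h x r s)
    (ih : ∀ h' x' r' s', r' + s' < r + s → Main N h' x' r' s' →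
      Sec (h' ::ₘ ones r') (x' ::ₘ ones s'))
    (hhx : h = x) (hh : 2 ≤ h) : Fst ((2 * h) ::ₘ ones r) (ones s) := by
  obtain ⟨h1, h2, h3, h4, h5, h6, h7, h8⟩ := H
  subst hhx
  obtain rfl | hs3 : s = 2 ∨ 3 ≤ s := by omega
  · exact .mergeRight 1 1 0 (Lonely.sec (lonely_cons
      (by omega) (by omega) (by omega) (by omega) (by omega))).symm
  obtain rfl | hr3 : r = 2 ∨ 3 ≤ r := by omega
  · by_cases hN : 2 * h + 2 = N
    · obtain ⟨s, rfl⟩ := Nat.exists_eq_add_of_le' (show 2 ≤ s by omega)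
      refine .coverRight 1 ((2 * h) ::ₘ {1}) (1 ::ₘ ones s) ?_
      rw [Multiset.cons_swap]
      exact sec_pair_one_of_balanced (by omega) (by omega) (by omega) (by omega) (by omega)
    · refine .mergeLeft 1 1 {2 * h} (sec_pair ?_ ?_ ?_ (by simp; omega) (by simp; omega)
        (by simp; omega) fun y hy => Or.inr ?_) <;>
      simp only [mem_ones] <;> omega
  · obtain ⟨s, rfl⟩ := Nat.exists_eq_add_of_le' (show 1 ≤ s by omega)
    obtain ⟨r, rfl⟩ := Nat.exists_eq_add_of_le' (show 1 ≤ r by omega)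
    -- `N` has the other parity than `h`. For `h` even the tall heights must be even, so they become
    -- `2 * h` and 2; for `h` odd they become `2 * h + 1` and 1.
    rcases Nat.mod_two_eq_zero_or_one h with hp | hp
    · exact .coverRight 1 ((2 * h) ::ₘ ones r) (ones s) (ih (2 * h) 2 r s (by omega)
        (by constructor <;> omega))
    · refine .mergeLeft (2 * h) 1 (ones r) ?_
      rw [ones_succ]
      exact ih (2 * h + 1) 1 r s (by omega) (by constructor <;> omega)

theorem allCovers_of_main {N h x r s : ℕ} (H : Main N h x r s) (hr : ¬ (h = 1 ∧ r = 2))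
    (hs : ¬ (x = 1 ∧ s = 2))
    (ih : ∀ h' x' r' s', r' + s' < r + s → Main N h' x' r' s' →
      Sec (h' ::ₘ ones r') (x' ::ₘ ones s')) :
    AllCovers (h ::ₘ ones r) (x ::ₘ ones s) Fst := by
  have key : ∀ r' s', r = r' + 1 → s = s' + 1 → Fst (2 ::ₘ h ::ₘ ones r') (x ::ₘ ones s') :=
    fun r' s' => fst_of_single_cover H hr hs ih
  have key' := fst_of_main_cover H ih
  obtain ⟨h1, h2, h3, h4, h5, h6, h7, h8⟩ := H
  simp only [allCovers_iff, allPicks_cons, allPicks_ones, allPicksOf_cons, allPicksOf_ones]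
  obtain ⟨r, rfl⟩ := Nat.exists_eq_add_of_le' (show 1 ≤ r by omega)
  obtain ⟨s, rfl⟩ := Nat.exists_eq_add_of_le' (show 1 ≤ s by omega)
  refine ⟨⟨?_, ?_⟩, ?_⟩
  · intro hhx
    by_cases hh1 : h = 1
    · obtain rfl : x = 1 := by omega
      subst hh1
      rw [ones_succ r, ones_succ s]
      exact key r s rfl rfl
    · exact key' hhx (by omega)
  · intro hh1 s' hs'
    obtain rfl : s = s' := by omega
    subst hh1
    rw [ones_succ r]
    exact key r s rfl rfl
  · intro r' hr'
    obtain rfl : r = r' := by omega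
    refine ⟨?_, ?_⟩
    · intro hx1
      subst hx1
      rw [ones_succ s]
      exact key r s rfl rfl
    · intro _ s' hs'
      obtain rfl : s = s' := by omega
      exact key r s rfl rfl

theorem Main.sec {N h x r s : ℕ} (H : Main N h x r s) : Sec (h ::ₘ ones r) (x ::ₘ ones s) := by
  obtain ⟨n, hn⟩ : ∃ n, n = r + s := ⟨_, rfl⟩
  induction n using Nat.strong_induction_on generalizing h x r s with
  | _ n ih =>
  have small : ∀ {h x r s : ℕ}, Main N h x r s → h = 1 ∧ r = 2 →
      Sec (h ::ₘ ones r) (x ::ₘ ones s) := by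
    rintro h x r s ⟨h1, h2, h3, h4, h5, h6, h7, h8⟩ ⟨rfl, rfl⟩
    rw [← ones_succ]
    exact sec_ones_three (by omega) (by omega) (by omega) (by omega)
  by_cases hr : h = 1 ∧ r = 2
  · exact small H hr
  by_cases hs : x = 1 ∧ s = 2
  · exact (small H.symm hs).symm
  have ih₁ : ∀ h' x' r' s', r' + s' < r + s → Main N h' x' r' s' →
      Sec (h' ::ₘ ones r') (x' ::ₘ ones s') := fun _ _ _ _ hlt h => ih _ (by omega) h rfl
  have ih₂ : ∀ h' x' r' s', r' + s' < s + r → Main N h' x' r' s' →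
      Sec (h' ::ₘ ones r') (x' ::ₘ ones s') := fun _ _ _ _ hlt h => ih _ (by omega) h rfl
  exact .of_forall (allMerges_of_main H hr ih₁)
    (fun B' hB => (allMerges_of_main H.symm hs ih₂ B' hB).symm) (allCovers_of_main H hr hs ih₁)
    (fun B' A' h => (allCovers_of_main H.symm hs hr ih₂ B' A' h).symm)

-- Positions behind the wins of the first player.

theorem sec_zero {B : Multiset ℕ} (h : Multiset.card B % 2 = 1) : Sec 0 B := by
  intro c d P _ hP
  have hcard := congrArg Multiset.card hP
  have hmem : ∀ s ∈ P, s.head? = some d := by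
    intro s hs
    have : (s.head?, s.length) ∈ P.map fun s => (s.head?, s.length) :=
      Multiset.mem_map_of_mem (fun s : Stack => (s.head?, s.length)) hs
    rw [hP] at this
    simp only [Multiset.map_zero, zero_add, Multiset.mem_map] at this
    obtain ⟨b, -, hb⟩ := this
    exact (Prod.ext_iff.1 hb).1.symm
  simp only [Multiset.card_map, Multiset.map_zero, zero_add] at hcard
  refine (wins_of_head_eq (some d) hmem ?_).1 (Nat.odd_iff.2 (by omega))
  rintro s hs rfl
  simpa using hmem _ hs

/-- The opponent can only merge two ones, and the new 2 covers the left stack, leaving one top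
color. -/
theorem sec_two_ones {s : ℕ} (hs : s % 2 = 0) : Sec {2} (ones s) := by
  refine Sec.of_forall ?_ ?_ ?_ ?_ <;> simp only [allCovers_iff,
    allMerges_singleton, allMerges_ones, allPicks_singleton, allPicks_ones,
    allPicksOf_singleton, allPicksOf_ones]
  · rintro s rfl
    exact .coverRight 2 0 (ones s) (sec_zero (by simp; omega))
  · omega
  · omega

theorem allMerges_of_odd {h x r s : ℕ} (hh : 2 ≤ h) (hx : 2 ≤ x) (hhx : (h + x) % 2 = 1)
    (hrs : (r + s) % 2 = 0)
    (ih : ∀ h' x' r' s', r' + s' < r + s → 2 ≤ h' → 2 ≤ x' → (h' + x') % 2 = 1 →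
      (r' + s') % 2 = 0 → Sec (h' ::ₘ ones r') (x' ::ₘ ones s')) :
    AllMerges (h ::ₘ ones r) fun A' => Fst A' (x ::ₘ ones s) := by
  simp only [allMerges_cons, allMerges_ones, allPicks_ones]
  refine ⟨?_, ?_⟩
  · rintro r rfl
    by_cases hr : r = 0
    · subst hr
      obtain ⟨s, rfl⟩ := Nat.exists_eq_add_of_le' (show 1 ≤ s by omega)
      exact .mergeRight x 1 (ones s) (ih (h + 1) (x + 1) 0 s (by omega) (by omega) (by omega)
        (by omega) (by omega))
    · obtain ⟨r, rfl⟩ := Nat.exists_eq_add_of_le' (show 1 ≤ r by omega)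
      exact .mergeLeft (h + 1) 1 (ones r) (ih (h + 1 + 1) x r s (by omega) (by omega) (by omega)
        (by omega) (by omega))
  · rintro r rfl
    exact .mergeLeft h 2 (ones r) (ih (h + 2) x r s (by omega) (by omega) (by omega)
      (by omega) (by omega))

theorem allCovers_of_odd {h x r s : ℕ} (hh : 2 ≤ h) (hx : 2 ≤ x) (hhx : (h + x) % 2 = 1)
    (hrs : (r + s) % 2 = 0)
    (ih : ∀ h' x' r' s', r' + s' < r + s → 2 ≤ h' → 2 ≤ x' → (h' + x') % 2 = 1 →
      (r' + s') % 2 = 0 → Sec (h' ::ₘ ones r') (x' ::ₘ ones s')) :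
    AllCovers (h ::ₘ ones r) (x ::ₘ ones s) Fst := by
  simp only [allCovers_iff, allPicks_cons, allPicks_ones, allPicksOf_cons, allPicksOf_ones]
  refine ⟨⟨by omega, by omega⟩, ?_⟩
  rintro r rfl
  refine ⟨by omega, ?_⟩
  rintro - s rfl
  exact .mergeLeft h 2 (ones r) (ih (h + 2) x r s (by omega) (by omega) (by omega)
    (by omega) (by omega))

/-- Tall stacks of different parity can cover neither each other nor a one. Each reply absorbs loose
chips so that the height sum stays odd. -/
theorem sec_cons_ones_cons_ones_of_odd {h x r s : ℕ} (hh : 2 ≤ h) (hx : 2 ≤ x)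
    (hhx : (h + x) % 2 = 1) (hrs : (r + s) % 2 = 0) : Sec (h ::ₘ ones r) (x ::ₘ ones s) := by
  obtain ⟨n, hn⟩ : ∃ n, n = r + s := ⟨_, rfl⟩
  induction n using Nat.strong_induction_on generalizing h x r s with
  | _ n ih =>
  have ih₁ : ∀ h' x' r' s', r' + s' < r + s → 2 ≤ h' → 2 ≤ x' → (h' + x') % 2 = 1 →
      (r' + s') % 2 = 0 → Sec (h' ::ₘ ones r') (x' ::ₘ ones s') :=
    fun _ _ _ _ hlt h1 h2 h3 h4 => ih _ (by omega) h1 h2 h3 h4 rfl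
  have ih₂ : ∀ h' x' r' s', r' + s' < s + r → 2 ≤ h' → 2 ≤ x' → (h' + x') % 2 = 1 →
      (r' + s') % 2 = 0 → Sec (h' ::ₘ ones r') (x' ::ₘ ones s') :=
    fun _ _ _ _ hlt h1 h2 h3 h4 => ih _ (by omega) h1 h2 h3 h4 rfl
  exact .of_forall (allMerges_of_odd hh hx hhx hrs ih₁)
    (fun B' hB => (allMerges_of_odd hx hh (by omega) (by omega) ih₂ B' hB).symm)
    (allCovers_of_odd hh hx hhx hrs ih₁)
    (fun B' A' h => (allCovers_of_odd hx hh (by omega) (by omega) ih₂ B' A' h).symm)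

/-- The right side builds its tall stack, 2 or 3, with the parity opposite to the left one. `r < s`
ensures that it keeps enough ones for this. -/
theorem sec_cons_ones_ones {x r s : ℕ} (hx : 2 ≤ x) (hx2 : x % 2 = 0) (hrs : (r + s) % 2 = 1)
    (hlt : r < s) : Sec (x ::ₘ ones r) (ones s) := by
  induction r using Nat.strong_induction_on generalizing x s with
  | _ r ih =>
  refine Sec.of_forall ?_ ?_ ?_ ?_ <;> simp only [allCovers_iff, allMerges_cons,
    allMerges_ones, allPicks_cons, allPicks_ones, allPicksOf_cons, allPicksOf_ones, mul_one]
  · refine ⟨?_, ?_⟩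
    · rintro r rfl
      obtain ⟨s, rfl⟩ := Nat.exists_eq_add_of_le' (show 2 ≤ s by omega)
      exact .mergeRight 1 1 (ones s) (sec_cons_ones_cons_ones_of_odd (by omega) (by omega)
        (by omega) (by omega))
    · rintro r rfl
      exact .mergeLeft x 2 (ones r) (ih r (by omega) (by omega) (by omega) (by omega) (by omega))
  · rintro s rfl
    by_cases hs : s = 0
    · subst hs
      obtain rfl : r = 1 := by omega
      exact .mergeLeft x 1 (ones 0) (sec_cons_ones_cons_ones_of_odd (by omega) (by omega)
        (by omega) (by omega))
    · obtain ⟨s, rfl⟩ := Nat.exists_eq_add_of_le' (show 1 ≤ s by omega)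
      exact .mergeRight 2 1 (ones s) (sec_cons_ones_cons_ones_of_odd (by omega) (by omega)
        (by omega) (by omega))
  · refine ⟨by omega, ?_⟩
    rintro r rfl - s rfl
    exact .mergeLeft x 2 (ones r) (ih r (by omega) (by omega) (by omega) (by omega) (by omega))
  · rintro s rfl
    refine ⟨by omega, ?_⟩
    rintro - r rfl
    obtain ⟨s, rfl⟩ := Nat.exists_eq_add_of_le' (show 1 ≤ s by omega)
    exact .mergeRight 2 1 (ones s) (sec_cons_ones_cons_ones_of_odd (by omega) (by omega)
      (by omega) (by omega))

-- Verified search for the small starts.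

/-- All pairs of a member of a list and the remaining list. -/
def picks : List ℕ → List (ℕ × List ℕ)
  | [] => []
  | a :: l => (a, l) :: (picks l).map fun p => (p.1, a :: p.2)

/-- All results of replacing two members of a list by their sum. -/
def merges (l : List ℕ) : List (List ℕ) :=
  (picks l).flatMap fun p => (picks p.2).map fun q => (p.1 + q.1) :: q.2

/-- All results of doubling a member of `l` at the expense of an equal member of `m`. -/
def covers (l m : List ℕ) : List (List ℕ × List ℕ) :=
  (picks l).flatMap fun p => ((picks m).filter fun q => q.1 = p.1).map fun q =>
    ((2 * p.1) :: p.2, q.2)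

/-- All results of a move, as sorted lists of heights. -/
def moves (l m : List ℕ) : List (List ℕ × List ℕ) :=
  ((((merges l).map fun l' => (l', m)) ++ ((merges m).map fun m' => (l, m')) ++
    covers l m ++ (covers m l).map Prod.swap).map fun p =>
      (p.1.insertionSort (· ≤ ·), p.2.insertionSort (· ≤ ·))).dedup

/-- A computable criterion for `Lonely`. -/
def lonelyTest (h : ℕ) (l : List ℕ) : Bool :=
  h ∉ l && l.length % 2 = 1 && l.sum ≠ h && (h % 2 = 1 || l.any (fun b => h / 2 < b) ||
    l.count (h / 2) + 3 ≤ l.length || l.length ≤ 3)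

/-- A search for a win of the second player, to the given depth. -/
def search : ℕ → List ℕ → List ℕ → Bool
  | 0, _, _ => false
  | n + 1, l, m => (match l with | [h] => lonelyTest h m | _ => false) ||
      (match m with | [h] => lonelyTest h l | _ => false) ||
      (moves l m).all fun p => (moves p.1 p.2).any fun q => search n q.1 q.2

theorem mem_picks {l l' : List ℕ} {a : ℕ} :
    (a, l') ∈ picks l → Pick (l : Multiset ℕ) a l' := by
  induction l generalizing l' with
  | nil => simp [picks]
  | cons b l ih =>
    simp only [picks, List.mem_cons, List.mem_map, Prod.mk.injEq, Prod.exists]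
    rintro (⟨rfl, rfl⟩ | ⟨x, m, h, rfl, rfl⟩)
    · rfl
    · rw [← Multiset.cons_coe, ← Multiset.cons_coe, pick_cons]
      exact Or.inr ⟨_, ih h, rfl⟩

theorem exists_mem_picks {l : List ℕ} {a : ℕ} {A : Multiset ℕ} (h : Pick (l : Multiset ℕ) a A) :
    ∃ l', (a, l') ∈ picks l ∧ A = l' := by
  induction l generalizing A with
  | nil => simp [pick_zero] at h
  | cons b l ih =>
    rw [← Multiset.cons_coe, pick_cons] at h
    rcases h with ⟨rfl, rfl⟩ | ⟨R, hR, rfl⟩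
    · exact ⟨l, by simp [picks], rfl⟩
    · obtain ⟨l', hl, rfl⟩ := ih hR
      exact ⟨b :: l', by simp [picks, hl], rfl⟩

theorem sec_of_forall_moves {l m : List ℕ} (h : ∀ p ∈ moves l m, Fst p.1 p.2) : Sec l m := by
  have key : ∀ p ∈ ((merges l).map fun l' => (l', m)) ++ ((merges m).map fun m' => (l, m')) ++
      covers l m ++ (covers m l).map Prod.swap, Fst p.1 p.2 := by
    intro p hp
    have := h _ (List.mem_dedup.2 (List.mem_map_of_mem hp))
    simpa only [Multiset.coe_eq_coe.2 (List.perm_insertionSort _ _)] using this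
  have hmerge : ∀ {l : List ℕ} {A}, Merge l A → ∃ l' ∈ merges l, A = l' := by
    rintro l A ⟨a, R, h1, b, S, h2, rfl⟩
    obtain ⟨l', k1, rfl⟩ := exists_mem_picks h1
    obtain ⟨l'', k2, rfl⟩ := exists_mem_picks h2
    exact ⟨(a + b) :: l'', List.mem_flatMap.2
      ⟨(a, l'), k1, List.mem_map.2 ⟨(b, l''), k2, rfl⟩⟩, rfl⟩
  have hcover : ∀ {l m : List ℕ} {A B}, Cover l m A B → ∃ p ∈ covers l m, A = p.1 ∧ B = p.2 := by
    rintro l m A B ⟨a, R, h1, h2, rfl⟩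
    obtain ⟨l', k1, rfl⟩ := exists_mem_picks h1
    obtain ⟨m', k2, rfl⟩ := exists_mem_picks h2
    exact ⟨((2 * a) :: l', m'), List.mem_flatMap.2 ⟨(a, l'), k1, List.mem_map.2
      ⟨(a, m'), List.mem_filter.2 ⟨k2, by simp⟩, rfl⟩⟩, rfl, rfl⟩
  simp only [List.mem_append, or_imp, forall_and, List.forall_mem_map] at key
  obtain ⟨⟨⟨k1, k2⟩, k3⟩, k4⟩ := key
  refine .intro (fun A' hA => ?_) (fun B' hB => ?_) (fun A' B' hc => ?_) (fun A' B' hc => ?_)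
  · obtain ⟨l', hl, rfl⟩ := hmerge hA
    exact k1 _ hl
  · obtain ⟨l', hl, rfl⟩ := hmerge hB
    exact k2 _ hl
  · obtain ⟨p, hp, rfl, rfl⟩ := hcover hc
    exact k3 _ hp
  · obtain ⟨p, hp, rfl, rfl⟩ := hcover hc
    exact k4 _ hp

theorem fst_of_mem_moves {l m : List ℕ} {p : List ℕ × List ℕ} (hp : p ∈ moves l m)
    (h : Sec p.1 p.2) : Fst l m := by
  obtain ⟨q, hq, rfl⟩ := List.mem_map.1 (List.mem_dedup.1 hp)
  simp only [Multiset.coe_eq_coe.2 (List.perm_insertionSort _ _)] at h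
  simp only [List.mem_append, List.mem_map, merges, covers, List.mem_flatMap, List.mem_filter,
    decide_eq_true_eq] at hq
  obtain ((⟨l', ⟨⟨a, l₁⟩, h1, ⟨b, l₂⟩, h2, rfl⟩, rfl⟩ |
    ⟨l', ⟨⟨a, l₁⟩, h1, ⟨b, l₂⟩, h2, rfl⟩, rfl⟩) |
    ⟨⟨a, l₁⟩, h1, ⟨b, l₂⟩, ⟨h2, rfl⟩, rfl⟩) | ⟨_, ⟨⟨a, l₁⟩, h1, ⟨b, l₂⟩, ⟨h2, rfl⟩, rfl⟩, rfl⟩ := hq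
  · exact .mergeLeft a b l₂ h ((mem_picks h1).trans (congrArg _ (mem_picks h2)))
  · exact .mergeRight a b l₂ h ((mem_picks h1).trans (congrArg _ (mem_picks h2)))
  · exact .coverLeft b l₁ l₂ h (mem_picks h1) (mem_picks h2)
  · exact .coverRight b l₂ l₁ h (mem_picks h2) (mem_picks h1)

theorem sec_of_lonelyTest {h : ℕ} {l : List ℕ} (H : lonelyTest h l = true) : Sec {h} l := by
  simp only [lonelyTest, Bool.and_eq_true, decide_eq_true_eq, Bool.or_eq_true,
    List.any_eq_true] at H
  obtain ⟨⟨⟨h1, h2⟩, h3⟩, h4⟩ := H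
  refine Lonely.sec ⟨by simpa using h1, by simpa, by simpa using h3, ?_⟩
  rintro y rfl
  rw [Nat.mul_div_cancel_left y (by omega)] at h4
  simp only [Multiset.mem_coe, Multiset.coe_count, Multiset.coe_card]
  rcases h4 with ((h4 | h4) | h4) | h4
  · omega
  · exact Or.inl h4
  · exact Or.inr (Or.inl h4)
  · exact Or.inr (Or.inr h4)

/-- Only soundness is needed. Each unit of depth is a move with its reply, and lonely stacks cut the
search short. -/
theorem sec_of_search {n : ℕ} {l m : List ℕ} (H : search n l m = true) : Sec l m := by
  induction n generalizing l m with
  | zero => simp [search] at H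
  | succ n ih =>
    simp only [search, Bool.or_eq_true, List.all_eq_true, List.any_eq_true] at H
    rcases H with (H | H) | H
    · split at H
      · exact sec_of_lonelyTest H
      · simp at H
    · split at H
      · exact (sec_of_lonelyTest H).symm
      · simp at H
    · refine sec_of_forall_moves fun p hp => ?_
      obtain ⟨q, hq, hs⟩ := H p hp
      exact fst_of_mem_moves hq (ih hs)

theorem sec_ones_ones_of_search {p q : ℕ} (n : ℕ)
    (H : search n (List.replicate p 1) (List.replicate q 1) = true) : Sec (ones p) (ones q) :=
  sec_of_search H

theorem sec_ones_three_ones_three : Sec (ones 3) (ones 3) :=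
  sec_ones_ones_of_search 3 (by decide +kernel)

theorem sec_ones_three_ones_five : Sec (ones 3) (ones 5) :=
  sec_ones_ones_of_search 4 (by decide +kernel)

theorem sec_ones_four_ones_four : Sec (ones 4) (ones 4) :=
  sec_ones_ones_of_search 4 (by decide +kernel)

theorem sec_ones_three_ones_seven : Sec (ones 3) (ones 7) :=
  sec_ones_ones_of_search 5 (by decide +kernel)

-- The starting positions.

theorem sec_ones_ones {p q : ℕ} (h3 : 3 ≤ p) (hpq : p ≤ q) (he : (p + q) % 2 = 0) :
    Sec (ones p) (ones q) := by
  obtain ⟨N, hN⟩ : ∃ N, p + q = 2 * N := ⟨(p + q) / 2, by omega⟩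
  rcases Nat.mod_two_eq_zero_or_one N with hN2 | hN2
  · by_cases hN6 : 6 ≤ N
    · obtain ⟨p, rfl⟩ := Nat.exists_eq_add_of_le' (show 1 ≤ p by omega)
      obtain ⟨q, rfl⟩ := Nat.exists_eq_add_of_le' (show 1 ≤ q by omega)
      rw [ones_succ, ones_succ]
      exact Main.sec (N := N) (by constructor <;> omega)
    · obtain ⟨rfl, rfl⟩ | ⟨rfl, rfl⟩ : (p = 3 ∧ q = 5) ∨ (p = 4 ∧ q = 4) := by omega
      · exact sec_ones_three_ones_five
      · exact sec_ones_four_ones_four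
  · by_cases hp3 : p = 3
    · subst hp3
      by_cases hN6 : 6 ≤ N
      · obtain ⟨q, rfl⟩ := Nat.exists_eq_add_of_le' (show 1 ≤ q by omega)
        rw [ones_succ q]
        exact sec_ones_three (by omega) (by omega) (by omega) (by omega)
      · obtain rfl | rfl : q = 3 ∨ q = 7 := by omega
        · exact sec_ones_three_ones_three
        · exact sec_ones_three_ones_seven
    · obtain ⟨p, rfl⟩ := Nat.exists_eq_add_of_le' (show 2 ≤ p by omega)
      obtain ⟨q, rfl⟩ := Nat.exists_eq_add_of_le' (show 2 ≤ q by omega)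
      -- For odd `N` the tall heights must be even; any opening move can be answered so that each
      -- side has exactly one 2.
      have key : Sec (2 ::ₘ ones p) (2 ::ₘ ones q) := Main.sec (N := N) (by constructor <;> omega)
      refine Sec.of_forall ?_ ?_ ?_ ?_ <;> simp only [allCovers_iff,
        allMerges_ones, allPicks_ones, allPicksOf_ones, mul_one]
      · intro r hr
        obtain rfl : p = r := by omega
        exact .mergeRight 1 1 (ones q) key
      · intro r hr
        obtain rfl : q = r := by omega
        exact .mergeLeft 1 1 (ones p) key
      · intro r hr _ s hs
        obtain rfl : r = p + 1 := by omega
        obtain rfl : s = q + 1 := by omega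
        exact .coverRight 1 (2 ::ₘ ones p) (ones q) key
      · intro s hs _ r hr
        obtain rfl : r = p + 1 := by omega
        obtain rfl : s = q + 1 := by omega
        exact .coverLeft 1 (ones p) (2 ::ₘ ones q) key

theorem fst_ones_ones {p q : ℕ} (h1 : 1 ≤ p) (hpq : p ≤ q) (h : (p + q) % 2 = 1 ∨ p ≤ 2) :
    Fst (ones p) (ones q) := by
  by_cases hodd : (p + q) % 2 = 1
  · obtain ⟨p, rfl⟩ := Nat.exists_eq_add_of_le' (show 1 ≤ p by omega)
    obtain ⟨q, rfl⟩ := Nat.exists_eq_add_of_le' (show 1 ≤ q by omega)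
    exact .coverLeft 1 (ones p) (ones q) (sec_cons_ones_ones (by omega) (by omega) (by omega)
      (by omega))
  · obtain rfl | rfl : p = 1 ∨ p = 2 := by omega
    · obtain ⟨q, rfl⟩ := Nat.exists_eq_add_of_le' (show 1 ≤ q by omega)
      exact .coverRight 1 0 (ones q) (sec_zero (by simp; omega))
    · exact .mergeLeft 1 1 0 (sec_two_ones (by omega))

theorem hasHeights_start (p q : ℕ) : HasHeights .red .blue (start p q) (ones p) (ones q) := by
  simp [HasHeights, start, ones]

end Babylon

theorem theorem1 (p q : ℕ) (hp : 1 ≤ p) (hpq : p ≤ q) :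
    (Babylon.SecondPlayerWins (Babylon.start p q) ↔ Even (p + q) ∧ 3 ≤ p) ∧
      (Babylon.FirstPlayerWins (Babylon.start p q) ↔ ¬ (Even (p + q) ∧ 3 ≤ p)) := by
  have hstart := Babylon.hasHeights_start p q
  by_cases h : Even (p + q) ∧ 3 ≤ p
  · have hs := Babylon.sec_ones_ones h.2 hpq (Nat.even_iff.1 h.1) _ _ _ (by simp) hstart
    exact ⟨iff_of_true hs h,
      iff_of_false (hs.not_firstPlayerWins) (not_not.2 h)⟩
  · have hf := Babylon.fst_ones_ones hp hpq (by rw [Nat.even_iff] at h; omega) _ _ _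
      (by simp) hstart
    exact ⟨iff_of_false (fun hs => hs.not_firstPlayerWins hf) h,
      iff_of_true hf h⟩
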